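/- All rings are commutative with $1\neq 0$. Let $R$ be a finite ring whose ideals are totally ordered by inclusion (a finite chain ring), let $\pi$ generate its maximal ideal, let $q=|R/\langle\pi\rangle|$, and let $s\ge 1$ be the least positive integer with $\pi^s=0$. A *shape* is a sequence of integers $\mu=(\mu_1,\dots,\mu_s)$ with $0\le\mu_1\le\cdots\le\mu_s$; put $\mu_0=0$ and $|\mu|=\sum_{i=1}^s\mu_i$. Let $R^\mu$ be the $R$-module of all $\mu_s$-tuples over $R$ whose coordinates with index in $\{\mu_l+1,\dots,\mu_{l+1}\}$ lie in $\langle\pi^l\rangle$, for $0\le l<s$. Let $R^{n\times\mu}$ be the set of $n\times\mu_s$ matrices with all rows in $R^\mu$. For a shape $\tau$, let $\mathcal T_\tau(R^{n\times\mu})$ be the set of matrices in $R^{n\times\mu}$ whose row span is isomorphic to $R^\tau$ as an $R$-module. Let $n\ge 0$ be an integer and let $\mu,\tau$ be shapes with $\tau_i\le n$ and $\tau_i\le\mu_i$ for all $i$. Then $\mathcal T_\tau(R^{n\times\mu})\ne\emptyset$. Consider the additive matrix channel $Y=X+Z$ with $X,Y\in R^{n\times\mu}$, where $Z$ is uniform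 over $\mathcal T_\tau(R^{n\times\mu})$ and independent of $X$. Let $C=\max_{p_X}I(X;Y)$ be its capacity, with logarithms to the base $q$. **(1) Capacity.** The capacity is $$C=\log_q|R^{n\times\mu}|-\log_q|\mathcal T_\tau(R^{n\times\mu})|,$$ and the maximum is attained by the uniform distribution of $X$ on $R^{n\times\mu}$. **(2) Bounds.** We have $$\sum_{i=1}^s(n-\tau_i)(\mu_i-\tau_i)-\log_q\Bigl(4^s\prod_{i=0}^{\tau_s-1}(1-q^{i-n})\Bigr)<C\le\sum_{i=1}^s(n-\tau_i)(\mu_i-\tau_i)-\log_q\prod_{i=0}^{\tau_s-1}(1-q^{i-n}),$$ and the second inequality is strict whenever $\tau_{i-1}<\tau_i<\mu_i$ for some $i\in\{1,\dots,s\}$. **(3) Asymptotic capacity.** Let $R$ be fixed and let the packet length $m=\mu_s$ tend to infinity while the ratios $\bar n=n/m>0$, $\bar\mu=\mu/m$ and $\bar\tau=\tau/m$ stay fixed (that is, along any sequence of admissible $(n,\mu,\tau)$ with these ratios and $m\to\infty$). Then $$\lim_{m\to\infty}\frac{C}{n|\mu|}=\frac{\sum_{i=1}^s(\bar n-\bar\tau_i)(\bar\mu_i-\bar\tau_i)}{\bar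 n\,|\bar\mu|},\qquad |\bar\mu|=\sum_{i=1}^s\bar\mu_i .$$ -/

import Mathlib

namespace AMC

/-! ### Finite chain rings and shapes -/

/-- A finite commutative ring `R` is a `(q, s)` chain ring and `π` generates its maximal ideal:
the ideals are totally ordered by inclusion, `⟨π⟩` is maximal, the residue field `R / ⟨π⟩` has `q`
elements, and `s` is the nilpotency index of `π` (so `s ≥ 1`, because `1 ≠ 0`). -/
structure IsFiniteChainRing (R : Type*) [CommRing R] [Finite R] (q s : ℕ) (π : R) : Prop where
  nontrivial : (1 : R) ≠ 0
  chain : ∀ I J : Ideal R, I ≤ J ∨ J ≤ I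
  maximal : (Ideal.span {π}).IsMaximal
  card_residue : Nat.card (R ⧸ Ideal.span {π}) = q
  nilpotency : IsLeast {k : ℕ | 0 < k ∧ π ^ k = 0} s

/-- An `s`-shape `0 ≤ μ₁ ≤ μ₂ ≤ ⋯ ≤ μₛ` (`part` is indexed from `0`). -/
structure Shape (s : ℕ) where
  part : Fin s → ℕ
  mono : Monotone part

/-- The component `μᵢ` in the usual numbering: `μ₀ = 0`, and `μᵢ` is the `i`-th part for
`1 ≤ i ≤ s`. Indices above `s` are never used. -/
def Shape.component {s : ℕ} (μ : Shape s) (i : ℕ) : ℕ :=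
  if h : 1 ≤ i ∧ i ≤ s then μ.part ⟨i - 1, by omega⟩ else 0

instance {s : ℕ} : CoeFun (Shape s) (fun _ => ℕ → ℕ) := ⟨Shape.component⟩

/-- `|μ| = μ₁ + ⋯ + μₛ`. -/
def Shape.size {s : ℕ} (μ : Shape s) : ℕ := ∑ i ∈ Finset.Icc 1 s, μ i

/-- `κ ⪯ μ`: `κ` is a subshape of `μ`. -/
def Shape.IsSubshape {s : ℕ} (κ μ : Shape s) : Prop := ∀ i ∈ Finset.Icc 1 s, κ i ≤ μ i

/-- `κ ⪯ n`, where the integer `n` stands for the shape `(n, …, n)`. -/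
def Shape.BoundedBy {s : ℕ} (κ : Shape s) (n : ℕ) : Prop := ∀ i ∈ Finset.Icc 1 s, κ i ≤ n

/-! ### The module `R^μ`, matrices with rows in it, and shapes of matrices -/

section Matrices

variable {R : Type*} [CommRing R] {s : ℕ}

/-- `R^μ = ⟨1⟩^{μ₁} × ⟨π⟩^{μ₂ - μ₁} × ⋯ × ⟨π^{s-1}⟩^{μₛ - μₛ₋₁}`: the tuples of length `μₛ` whose
coordinates number `μₗ + 1, …, μₗ₊₁` lie in `⟨π^l⟩`, for `0 ≤ l < s`
(the coordinate `j : Fin μₛ` is number `j + 1`). -/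
def shapeModule (π : R) (μ : Shape s) : Submodule R (Fin (μ s) → R) where
  carrier := {v | ∀ j : Fin (μ s), ∀ l < s, μ l ≤ j → (j : ℕ) < μ (l + 1) →
    v j ∈ Ideal.span {π ^ l}}
  add_mem' hv hw j l hl h₁ h₂ := Ideal.add_mem _ (hv j l hl h₁ h₂) (hw j l hl h₁ h₂)
  zero_mem' _ _ _ _ _ := Ideal.zero_mem _
  smul_mem' a _ hv j l hl h₁ h₂ := Ideal.mul_mem_left _ a (hv j l hl h₁ h₂)

/-- `R^{n × μ}`: the `n × μₛ` matrices all of whose rows lie in `R^μ`. -/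
def matrixModule (π : R) (n : ℕ) (μ : Shape s) : Submodule R (Matrix (Fin n) (Fin (μ s)) R) where
  carrier := {A | ∀ i, A.row i ∈ shapeModule π μ}
  add_mem' hA hB i := Submodule.add_mem _ (hA i) (hB i)
  zero_mem' _ := Submodule.zero_mem _
  smul_mem' a _ hA i := Submodule.smul_mem _ a (hA i)

noncomputable instance [Finite R] (π : R) (n : ℕ) (μ : Shape s) : Fintype (matrixModule π n μ) :=
  Fintype.ofFinite _

/-- The `R`-module `M` has shape `κ`: it is isomorphic to `R^κ`. -/
def HasShape (π : R) (M : Type*) [AddCommGroup M] [Module R M] (κ : Shape s) : Prop :=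
  Nonempty (M ≃ₗ[R] shapeModule π κ)

/-- The row span of a matrix. -/
def rowSpan {n m : ℕ} (A : Matrix (Fin n) (Fin m) R) : Submodule R (Fin m → R) :=
  Submodule.span R (Set.range A.row)

/-- `T_κ(R^{n × μ})`: the matrices in `R^{n × μ}` of shape `κ`, i.e. whose row span has
shape `κ`. -/
def matricesOfShape (π : R) (n : ℕ) (μ κ : Shape s) : Set (matrixModule π n μ) :=
  {A | HasShape π (rowSpan A.1) κ}

end Matrices

/-! ### Discrete memoryless channels -/

section Channels

variable {α β : Type*} [Fintype α] [Fintype β]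

/-- `I(X; Y)`, in units of `log b`, for a pair `(X, Y)` with joint probability mass function `P`;
the convention `0 log 0 = 0` is automatic. -/
noncomputable def mutualInformation (b : ℝ) (P : α → β → ℝ) : ℝ :=
  ∑ x, ∑ y, P x y * Real.logb b (P x y / ((∑ y', P x y') * ∑ x', P x' y))

/-- `I(X; Y)` when the input `X` has law `p` and `Y` is the output of the channel with transition
probabilities `W x y = p_{Y|X}(y | x)`. -/
noncomputable def channelInformation (b : ℝ) (W : α → β → ℝ) (p : stdSimplex ℝ α) : ℝ :=
  mutualInformation b (fun x y => p.1 x * W x y)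

/-- The capacity `max_{p_X} I(X; Y)`, the supremum being over all input distributions. -/
noncomputable def capacity (b : ℝ) (W : α → β → ℝ) : ℝ :=
  ⨆ p : stdSimplex ℝ α, channelInformation b W p

/-- The uniform input distribution. -/
noncomputable def uniformInput (α : Type*) [Fintype α] [Nonempty α] : stdSimplex ℝ α :=
  stdSimplex.barycenter

/-- The probability mass function of the uniform distribution over a (nonempty) set `T`. -/
noncomputable def uniformLaw (T : Set α) : α → ℝ :=
  T.indicator fun _ => 1 / (Nat.card T : ℝ)

/-- The transition probabilities of `Y = X + Z`, where `Z` is independent of `X` and has law `pZ`: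
`Pr(Y = y | X = x) = Pr(Z = y - x)`. -/
def additiveChannel {G : Type*} [AddGroup G] (pZ : G → ℝ) : G → G → ℝ :=
  fun x y => pZ (y - x)

end Channels

/-! ### The additive matrix channel -/

section AdditiveMatrixChannel

variable {R : Type*} [CommRing R] [Finite R] {s : ℕ}

/-- The additive matrix channel `Y = X + Z` with input and output alphabet `R^{n × μ}`, and `Z`
uniform over `T_τ(R^{n × μ})` and independent of `X`. -/
noncomputable def amc (π : R) (n : ℕ) (μ τ : Shape s) :
    matrixModule π n μ → matrixModule π n μ → ℝ :=
  additiveChannel (uniformLaw (matricesOfShape π n μ τ))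

/-- The product `∏_{i=0}^{τₛ-1} (1 - q^{i-n})`. -/
noncomputable def fullRankFactor (q n : ℕ) (τ : Shape s) : ℝ :=
  ∏ i ∈ Finset.range (τ s), (1 - (q : ℝ) ^ ((i : ℤ) - (n : ℤ)))

end AdditiveMatrixChannel

end AMC

namespace AMC

/-! ### Mutual information of additive channels with uniform noise on a finite group -/

section Channel

/-! For an additive channel on a finite group `G` with noise uniform on `T`, I(X; Y) = H(Y) - log
|T|. Jensen's inequality gives H(Y) ≤ log |G|, with equality for uniform input, so the capacity is
log |G| - log |T| and everything else reduces to computing |T_τ(R^{n×μ})|.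

A matrix of shape τ is an n-tuple of rows in R^μ generating a submodule isomorphic to R^τ. Such a
submodule is the image of an embedding of R^τ, and embeddings correspond to independent τ_s-tuples
whose annihilators are those of the standard generators of R^τ. Double counting pairs of a row tuple
and an independent tuple with the same span (`IndepOfType.card_tuples_mul`) gives |T_τ| · |Aut R^τ|
= |Emb(R^τ, R^μ)| · |{generating n-tuples of R^τ}|. Independent tuples are counted by adding one
vector at a time (`card_extensions`), generating tuples by reduction to the residue field with
Nakayama (`card_generating_tuples`).

Write E(τ, μ) for `embeddingFactor` and F for `fullRankFactor`. The embeddings number q^{Σ τ_i μ_i}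
E(τ, μ), the automorphisms q^{Σ τ_i²} E(τ, τ), the generating tuples q^{n|τ|} F. Hence C = Σ (n -
τ_i)(μ_i - τ_i) - log F - log (E(τ, μ) / E(τ, τ)). The bounds follow from 4^{-s} < E(τ, τ) ≤ E(τ, μ)
≤ 1. As also 1/4 < F ≤ 1, the deviation of C from the sum is bounded independently of n, μ, τ, while
the sum and the normalisation n|μ| scale as m²; this gives the limit. -/

lemma sum_uniformLaw {G : Type*} [Fintype G] {T : Set G} (hT : T.Nonempty) :
    ∑ z, uniformLaw T z = 1 := by
  classical
  have : (Nat.card T : ℝ) ≠ 0 := by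
    have := hT.to_subtype
    exact_mod_cast Nat.card_pos.ne'
  rw [uniformLaw, Finset.sum_indicator_eq_sum_filter, Finset.sum_const, nsmul_eq_mul,
    Nat.card_eq_fintype_card, Fintype.card_subtype]
  rw [Nat.card_eq_fintype_card, Fintype.card_subtype] at this
  field_simp

lemma uniformLaw_nonneg {G : Type*} (T : Set G) (z : G) : 0 ≤ uniformLaw T z :=
  Set.indicator_nonneg (fun _ _ => by positivity) z

variable {G : Type*} [AddGroup G] [Fintype G]

/-- This is I(X; Y) = H(Y) - H(Z) with H(Z) = log |T|. Wherever the joint mass is nonzero, the ratio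
inside the logarithm is 1 / (|T| Q(y)), with Q the law of Y. -/
lemma channelInformation_additiveChannel (b : ℝ) {T : Set G} (hT : T.Nonempty)
    (p : stdSimplex ℝ G) :
    channelInformation b (additiveChannel (uniformLaw T)) p =
      (∑ y, Real.negMulLog (∑ x, p.1 x * uniformLaw T (y - x))) / Real.log b -
        Real.logb b (Nat.card T) := by
  have hcard : (Nat.card T : ℝ) ≠ 0 := by
    have := hT.to_subtype
    exact_mod_cast Nat.card_pos.ne'
  have hrow (x : G) : ∑ y, uniformLaw T (y - x) = 1 := by
    rw [← sum_uniformLaw hT]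
    exact Fintype.sum_equiv (Equiv.subRight x) _ _ fun _ => rfl
  set Q : G → ℝ := fun y => ∑ x, p.1 x * uniformLaw T (y - x) with hQ
  have hterm (x y : G) : p.1 x * uniformLaw T (y - x) *
      Real.logb b (p.1 x * uniformLaw T (y - x) /
        ((∑ y', p.1 x * uniformLaw T (y' - x)) * Q y)) =
      p.1 x * uniformLaw T (y - x) * (-Real.logb b (Nat.card T) - Real.logb b (Q y)) := by
    rcases eq_or_ne (p.1 x) 0 with hx | hx
    · simp [hx]
    by_cases hy : y - x ∈ T
    swap
    · simp [uniformLaw, hy]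
    have hu : uniformLaw T (y - x) = 1 / (Nat.card T : ℝ) := by simp [uniformLaw, hy]
    have hQpos : 0 < Q y := by
      refine Finset.sum_pos' (fun z _ => mul_nonneg (p.2.1 z) (uniformLaw_nonneg _ _))
        ⟨x, Finset.mem_univ _, ?_⟩
      refine mul_pos (lt_of_le_of_ne (p.2.1 x) hx.symm) ?_
      rw [hu]
      positivity
    congr 1
    rw [← Finset.mul_sum, hrow, hu, mul_one, mul_div_mul_left _ _ hx,
      Real.logb_div (by positivity) hQpos.ne', Real.logb_div one_ne_zero hcard, Real.logb_one,
      zero_sub]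
  have htot : ∑ y, Q y = 1 := by
    rw [hQ, Finset.sum_comm]
    simp_rw [← Finset.mul_sum, hrow, mul_one]
    exact p.2.2
  calc channelInformation b (additiveChannel (uniformLaw T)) p
      = ∑ x, ∑ y, p.1 x * uniformLaw T (y - x) *
          (-Real.logb b (Nat.card T) - Real.logb b (Q y)) := by
        simp only [channelInformation, mutualInformation, additiveChannel]
        exact Finset.sum_congr rfl fun x _ => Finset.sum_congr rfl fun y _ => hterm x y
    _ = ∑ y, Q y * (-Real.logb b (Nat.card T) - Real.logb b (Q y)) := by
        rw [Finset.sum_comm]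
        simp_rw [← Finset.sum_mul]
        rfl
    _ = _ := by
        simp_rw [mul_sub, Finset.sum_sub_distrib, ← Finset.sum_mul, htot, Finset.sum_div,
          Real.negMulLog, Real.logb]
        rw [one_mul, sub_eq_add_neg, ← Finset.sum_neg_distrib, add_comm, ← sub_eq_add_neg]
        congr 1
        exact Finset.sum_congr rfl fun y _ => by ring

lemma channelInformation_additiveChannel_le {b : ℝ} (hb : 1 < b) {T : Set G} (hT : T.Nonempty)
    (p : stdSimplex ℝ G) :
    channelInformation b (additiveChannel (uniformLaw T)) p ≤
      Real.logb b (Nat.card G) - Real.logb b (Nat.card T) := by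
  have hrow (x : G) : ∑ y, uniformLaw T (y - x) = 1 := by
    rw [← sum_uniformLaw hT]
    exact Fintype.sum_equiv (Equiv.subRight x) _ _ fun _ => rfl
  have hG : (Fintype.card G : ℝ) ≠ 0 := by
    have := hT.nonempty
    exact_mod_cast Fintype.card_ne_zero
  have htot : ∑ y, ∑ x, p.1 x * uniformLaw T (y - x) = 1 := by
    rw [Finset.sum_comm]
    simp_rw [← Finset.mul_sum, hrow, mul_one]
    exact p.2.2
  rw [channelInformation_additiveChannel b hT]
  refine sub_le_sub_right (div_le_div_of_nonneg_right ?_ (Real.log_pos hb).le) _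
  -- Jensen with equal weights: the mean of -Q log Q is at most its value at the mean 1/|G| of Q.
  have key := Real.concaveOn_negMulLog.le_map_sum (t := Finset.univ)
    (w := fun _ : G => (Fintype.card G : ℝ)⁻¹)
    (p := fun y => ∑ x, p.1 x * uniformLaw T (y - x)) (fun _ _ => by positivity)
    (by simp [hG]) (fun y _ => Finset.sum_nonneg fun x _ =>
      mul_nonneg (p.2.1 x) (uniformLaw_nonneg _ _))
  simp only [smul_eq_mul, ← Finset.mul_sum, htot, mul_one] at key
  rw [Real.negMulLog, Real.log_inv, neg_mul_neg] at key
  rw [Nat.card_eq_fintype_card]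
  exact le_of_mul_le_mul_left key (by positivity)

lemma channelInformation_uniformInput [Nonempty G] (b : ℝ) {T : Set G} (hT : T.Nonempty) :
    channelInformation b (additiveChannel (uniformLaw T)) (uniformInput G) =
      Real.logb b (Nat.card G) - Real.logb b (Nat.card T) := by
  have hG : (Fintype.card G : ℝ) ≠ 0 := by exact_mod_cast Fintype.card_ne_zero
  have hcol (y : G) : ∑ x, uniformLaw T (y - x) = 1 := by
    rw [← sum_uniformLaw hT]
    exact Fintype.sum_equiv (Equiv.subLeft y) _ _ fun _ => rfl
  have hp (x : G) : (uniformInput G).1 x = (Fintype.card G : ℝ)⁻¹ := by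
    simp [uniformInput, stdSimplex.barycenter]
  rw [channelInformation_additiveChannel b hT]
  simp_rw [hp, ← Finset.mul_sum, hcol, mul_one, Real.negMulLog, Real.log_inv]
  rw [Finset.sum_const, Finset.card_univ, nsmul_eq_mul, neg_mul_neg,
    mul_inv_cancel_left₀ hG, Nat.card_eq_fintype_card (α := G), Real.log_div_log]

lemma capacity_eq_of_forall_le {α β : Type*} [Fintype α] [Fintype β] {b : ℝ} {W : α → β → ℝ}
    {p : stdSimplex ℝ α} (h : ∀ p', channelInformation b W p' ≤ channelInformation b W p) :
    capacity b W = channelInformation b W p :=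
  have : Nonempty (stdSimplex ℝ α) := ⟨p⟩
  -- A real supremum is meaningful only for a nonempty family bounded above; the maximiser `p`
  -- supplies both.
  le_antisymm (ciSup_le h) (le_ciSup ⟨_, Set.forall_mem_range.2 h⟩ p)

end Channel

/-! ### Fibre counts for homomorphisms of finite modules -/

section FiniteModules

lemma card_ker_mul_card_range {R M N : Type*} [Ring R] [AddCommGroup M] [Module R M]
    [AddCommGroup N] [Module R N] (f : M →ₗ[R] N) :
    Nat.card (LinearMap.ker f) * Nat.card (LinearMap.range f) = Nat.card M := by
  rw [Submodule.card_eq_card_quotient_mul_card (LinearMap.ker f),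
    Nat.card_congr f.quotKerEquivRange.toEquiv]

lemma card_comap_of_le_range {R M N : Type*} [Ring R] [AddCommGroup M] [Module R M]
    [AddCommGroup N] [Module R N] (f : M →ₗ[R] N) {W : Submodule R N}
    (hW : W ≤ LinearMap.range f) :
    Nat.card (W.comap f) = Nat.card (LinearMap.ker f) * Nat.card W := by
  have h := card_ker_mul_card_range (f.submoduleComap W)
  rw [LinearMap.range_eq_top.2, Nat.card_congr Submodule.topEquiv.toEquiv] at h
  · rw [← h]
    congr 1
    refine Nat.card_congr ⟨fun x => ⟨x.1.1, ?_⟩, fun x => ⟨⟨x.1, ?_⟩, ?_⟩, fun _ => rfl, fun _ => rfl⟩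
    · exact congrArg Subtype.val x.2
    · simp [LinearMap.mem_ker.1 x.2]
    · exact Subtype.ext x.2
  · rintro ⟨w, hw⟩
    obtain ⟨x, rfl⟩ := hW hw
    exact ⟨⟨x, hw⟩, rfl⟩

lemma card_preimage_of_surjective {A B : Type*} [AddCommGroup A] [AddCommGroup B] [Finite A]
    (f : A →+ B) (hf : Function.Surjective f) (S : Set B) :
    Nat.card (f ⁻¹' S) = Nat.card f.ker * Nat.card S := by
  have hfin : Finite B := Finite.of_surjective f hf
  have : Nat.card (f ⁻¹' S) = Nat.card (S × f.ker) := by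
    refine Nat.card_congr ⟨fun x => (⟨f x.1, x.2⟩, ⟨x.1 - (hf (f x.1)).choose, ?_⟩),
      fun x => ⟨x.2.1 + (hf x.1.1).choose, ?_⟩, fun x => ?_, fun x => ?_⟩
    · rw [AddMonoidHom.mem_ker, map_sub, (hf (f x.1)).choose_spec, sub_self]
    · rw [Set.mem_preimage, map_add, (hf x.1.1).choose_spec, AddMonoidHom.mem_ker.1 x.2.2, zero_add]
      exact x.1.2
    · simp
    · have h : f (x.2.1 + (hf x.1.1).choose) = x.1.1 := by
        rw [map_add, (hf x.1.1).choose_spec, AddMonoidHom.mem_ker.1 x.2.2, zero_add]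
      refine Prod.ext (Subtype.ext h) (Subtype.ext ?_)
      simp [h]
  rw [this, Nat.card_prod, mul_comm]

/-- Surjective homomorphisms of finite groups preserve density, so |S|/|B| and |T|/|C| both equal
the density in `A` of the common preimage. -/
lemma card_mul_card_of_preimage_eq {A B C : Type*} [AddCommGroup A] [AddCommGroup B]
    [AddCommGroup C] [Finite A] (f : A →+ B) (g : A →+ C) (hf : Function.Surjective f)
    (hg : Function.Surjective g) {S : Set B} {T : Set C} (h : f ⁻¹' S = g ⁻¹' T) :
    Nat.card S * Nat.card C = Nat.card T * Nat.card B := by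
  have hS := card_preimage_of_surjective f hf S
  have hT := card_preimage_of_surjective g hg T
  have hB := card_preimage_of_surjective f hf Set.univ
  have hC := card_preimage_of_surjective g hg Set.univ
  rw [Set.preimage_univ, Nat.card_univ, Nat.card_univ] at hB hC
  have hA : 0 < Nat.card A := Nat.card_pos
  rw [h, hT] at hS
  refine Nat.eq_of_mul_eq_mul_left (Nat.mul_pos
    (Nat.pos_of_mul_pos_right (hB ▸ hA)) (Nat.pos_of_mul_pos_right (hC ▸ hA))) ?_
  calc Nat.card f.ker * Nat.card g.ker * (Nat.card S * Nat.card C)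
      = (Nat.card f.ker * Nat.card S) * (Nat.card g.ker * Nat.card C) := by ring
    _ = (Nat.card g.ker * Nat.card T) * (Nat.card f.ker * Nat.card B) := by rw [← hS, ← hC, ← hB]
    _ = _ := by ring

end FiniteModules

/-! ### Divisibility by powers of π and the sizes of the ideals ⟨π^i⟩ -/

namespace IsFiniteChainRing

variable {R : Type*} [CommRing R] [Finite R] {q s : ℕ} {π : R}

/-- ⟨π⟩ is the only maximal ideal, because any other would be comparable with it. -/
lemma isUnit_or_dvd (hR : IsFiniteChainRing R q s π) (r : R) : IsUnit r ∨ π ∣ r := by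
  by_contra! h
  obtain ⟨m, hm, hr⟩ := exists_max_ideal_of_mem_nonunits (mem_nonunits_iff.2 h.1)
  have : m = Ideal.span {π} := by
    rcases hR.chain m (Ideal.span {π}) with hle | hle
    · exact hm.eq_of_le hR.maximal.ne_top hle
    · exact (hR.maximal.eq_of_le hm.ne_top hle).symm
  exact h.2 (Ideal.mem_span_singleton.1 (this ▸ hr))

lemma pos (hR : IsFiniteChainRing R q s π) : 0 < s := hR.nilpotency.1.1

lemma pow_eq_zero (hR : IsFiniteChainRing R q s π) : π ^ s = 0 := hR.nilpotency.1.2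

lemma one_lt (hR : IsFiniteChainRing R q s π) : 1 < q := by
  have := Ideal.Quotient.nontrivial_iff.2 hR.maximal.ne_top
  have : Finite (R ⧸ Ideal.span {π}) := Finite.of_surjective _ Ideal.Quotient.mk_surjective
  rw [← hR.card_residue]
  exact Finite.one_lt_card

lemma exists_isUnit_mul_pow (hR : IsFiniteChainRing R q s π) (r : R) :
    ∃ u : R, IsUnit u ∧ ∃ e ≤ s, r = u * π ^ e := by
  classical
  set e := Nat.findGreatest (fun e => π ^ e ∣ r) s with he
  have hes : e ≤ s := Nat.findGreatest_le s
  obtain ⟨t, ht⟩ : π ^ e ∣ r := Nat.findGreatest_spec (P := fun e => π ^ e ∣ r) s.zero_le (by simp)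
  rcases hes.eq_or_lt with h | h
  · exact ⟨1, isUnit_one, s, le_rfl, by rw [ht, h, hR.pow_eq_zero]; simp⟩
  rcases hR.isUnit_or_dvd t with hu | ⟨t', ht'⟩
  · exact ⟨t, hu, e, hes, by rw [ht, mul_comm]⟩
  · have hdvd : π ^ (e + 1) ∣ r := ⟨t', by rw [ht, ht', pow_succ, mul_assoc]⟩
    have := Nat.le_findGreatest (P := fun e => π ^ e ∣ r) h hdvd
    omega

/-- If π^j = π^i t with j < i, then π^j (1 - π^{i-j} t) = 0. The bracket is 1 minus a nilpotent,
hence a unit, so π^j = 0, against the minimality of s. -/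
lemma le_of_pow_dvd_pow (hR : IsFiniteChainRing R q s π) {i j : ℕ} (hi : i ≤ s)
    (h : π ^ i ∣ π ^ j) : i ≤ j := by
  by_contra! hji
  obtain ⟨t, ht⟩ := h
  have hnil : IsNilpotent (π ^ (i - j) * t) := by
    refine ⟨s, ?_⟩
    rw [mul_pow, ← pow_mul, mul_comm, pow_mul', hR.pow_eq_zero, zero_pow (by omega), mul_zero]
  have h0 : π ^ j * (1 - π ^ (i - j) * t) = 0 := by
    rw [mul_sub, mul_one, ← mul_assoc, ← pow_add, Nat.add_sub_cancel' hji.le, ← ht, sub_self]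
  have hj : π ^ j = 0 := (hnil.isUnit_one_sub.mul_left_eq_zero).1 h0
  rcases Nat.eq_zero_or_pos j with rfl | hpos
  · exact hR.nontrivial (by simpa using hj)
  · exact absurd (hR.nilpotency.2 ⟨hpos, hj⟩) (by omega)

lemma pow_dvd_of_pow_add_dvd (hR : IsFiniteChainRing R q s π) {i e : ℕ} (hi : i + e ≤ s) {r : R}
    (h : π ^ (i + e) ∣ π ^ e * r) : π ^ i ∣ r := by
  obtain ⟨u, hu, k, -, rfl⟩ := hR.exists_isUnit_mul_pow r
  rw [mul_left_comm, hu.dvd_mul_left, ← pow_add] at h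
  have := hR.le_of_pow_dvd_pow hi h
  exact (pow_dvd_pow π (by omega)).mul_left u

lemma pow_mul_eq_zero_iff (hR : IsFiniteChainRing R q s π) {e : ℕ} (he : e ≤ s) {r : R} :
    π ^ e * r = 0 ↔ π ^ (s - e) ∣ r := by
  constructor
  · intro h
    refine hR.pow_dvd_of_pow_add_dvd (e := e) (by omega) ?_
    rw [h]
    exact dvd_zero _
  · rintro ⟨t, rfl⟩
    rw [← mul_assoc, ← pow_add, Nat.add_sub_cancel' he, hR.pow_eq_zero, zero_mul]

lemma card_eq_mul_card_span (hR : IsFiniteChainRing R q s π) :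
    Nat.card R = q * Nat.card (Ideal.span {π}) := by
  rw [← hR.card_residue]
  rw [Submodule.card_eq_card_quotient_mul_card (Ideal.span {π}), mul_comm]

/-- Multiplication by π maps ⟨π^i⟩ onto ⟨π^{i+1}⟩ with kernel ⟨π^{s-1}⟩. -/
lemma card_span_pow_mul (hR : IsFiniteChainRing R q s π) {i : ℕ} (hi : i < s) :
    Nat.card (Ideal.span {π ^ i}) =
      Nat.card (Ideal.span {π ^ (s - 1)}) * Nat.card (Ideal.span {π ^ (i + 1)}) := by
  have hcomap : Submodule.comap (LinearMap.mulLeft R π) (Ideal.span {π ^ (i + 1)}) = Ideal.span {π ^ i} := by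
    ext r
    rw [Submodule.mem_comap, Ideal.mem_span_singleton, Ideal.mem_span_singleton]
    refine ⟨fun h => hR.pow_dvd_of_pow_add_dvd (e := 1) hi (by simpa using h), ?_⟩
    rintro ⟨t, rfl⟩
    exact ⟨t, by simp [pow_succ']; ring⟩
  have hker : LinearMap.ker (LinearMap.mulLeft R π) = Ideal.span {π ^ (s - 1)} := by
    ext r
    rw [LinearMap.mem_ker, Ideal.mem_span_singleton, ← hR.pow_mul_eq_zero_iff hR.pos]
    simp
  rw [← hcomap, card_comap_of_le_range, hker]
  intro r hr
  obtain ⟨t, rfl⟩ := Ideal.mem_span_singleton.1 hr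
  exact ⟨π ^ i * t, by simp [pow_succ']; ring⟩

lemma card_span_pow (hR : IsFiniteChainRing R q s π) {i : ℕ} (hi : i ≤ s) :
    Nat.card (Ideal.span {π ^ i}) = q ^ (s - i) := by
  -- Compare the two factorisations of |R|: |⟨π^{s-1}⟩| · |⟨π⟩| from the kernel count at i = 0, and
  -- q · |⟨π⟩| from the residue field.
  have hq : Nat.card (Ideal.span {π ^ (s - 1)}) = q := by
    have h0 := hR.card_span_pow_mul hR.pos
    have h1 : Nat.card (Ideal.span {π ^ 0}) = Nat.card R := by
      rw [pow_zero, Ideal.span_singleton_one]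
      exact Nat.card_congr Submodule.topEquiv.toEquiv
    rw [h1, hR.card_eq_mul_card_span, zero_add, pow_one] at h0
    exact (Nat.eq_of_mul_eq_mul_right Nat.card_pos h0).symm
  induction hi using Nat.decreasingInduction with
  | self =>
    rw [hR.pow_eq_zero, Ideal.span_singleton_zero]
    simp
  | of_succ i hi ih =>
    rw [hR.card_span_pow_mul hi, ih, hq, ← pow_succ']
    congr 1
    omega

end IsFiniteChainRing

/-! ### Independent tuples with prescribed annihilators -/

section IndepOfType

variable {R M N : Type*} [CommRing R] [AddCommGroup M] [Module R M] [AddCommGroup N] [Module R N]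

/-- The tuple `y` is independent of type `c`: the annihilator of `y j` is `⟨π ^ c j⟩`, and the sum
of the cyclic modules generated by the `y j` is direct. -/
def IndepOfType (π : R) (c : ℕ → ℕ) {k : ℕ} (y : Fin k → M) : Prop :=
  ∀ r : Fin k → R, ∑ j, r j • y j = 0 ↔ ∀ j : Fin k, π ^ c j ∣ r j

lemma indepOfType_comp_iff {π : R} {c : ℕ → ℕ} {k : ℕ} {y : Fin k → M} {f : M →ₗ[R] N}
    (hf : Function.Injective f) : IndepOfType π c (f ∘ y) ↔ IndepOfType π c y := by
  refine forall_congr' fun r => ?_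
  have : ∑ j, r j • (f ∘ y) j = f (∑ j, r j • y j) := by simp
  rw [this, map_eq_zero_iff f hf]

variable [Finite R] {q s : ℕ} {π : R}

/-- A relation whose last coefficient is a unit times π^e with e < c_k can be multiplied by
π^{c_k-1-e}, which puts π^{c_k-1} y_k in the span of the earlier vectors. Excluding this one
multiple therefore excludes all unwanted relations. -/
lemma indepOfType_succ_iff (hR : IsFiniteChainRing R q s π) {c : ℕ → ℕ} {k : ℕ} (hc : 1 ≤ c k)
    (hcs : c k ≤ s) (y : Fin (k + 1) → M) :
    IndepOfType π c y ↔ IndepOfType π c (Fin.init y) ∧ π ^ c k • y (Fin.last k) = 0 ∧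
      π ^ (c k - 1) • y (Fin.last k) ∉ Submodule.span R (Set.range (Fin.init y)) := by
  constructor
  · intro h
    refine ⟨fun r => ?_, ?_, fun hmem => ?_⟩
    · have := h (Fin.snoc (α := fun _ => R) r 0)
      simpa [Fin.sum_univ_castSucc, Fin.forall_fin_succ', Fin.init] using this
    · have := (h (Fin.snoc (α := fun _ => R) 0 (π ^ c k))).2
      simpa [Fin.sum_univ_castSucc, Fin.forall_fin_succ'] using this
    · obtain ⟨r, hr⟩ := (Submodule.mem_span_range_iff_exists_fun R).1 hmem
      have := (h (Fin.snoc (α := fun _ => R) r (-π ^ (c k - 1)))).1 (by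
        simp only [Fin.init] at hr
        simp [Fin.sum_univ_castSucc, hr]) (Fin.last k)
      simp only [Fin.snoc_last, dvd_neg, Fin.val_last] at this
      have := hR.le_of_pow_dvd_pow hcs this
      omega
  · rintro ⟨h, h0, hspan⟩ r
    have hlast : ∑ j, r j • y j = 0 → π ^ c k ∣ r (Fin.last k) := by
      intro hr
      obtain ⟨u, hu, e, -, hue⟩ := hR.exists_isUnit_mul_pow (r (Fin.last k))
      rw [hue, hu.dvd_mul_left]
      refine pow_dvd_pow π ?_
      by_contra! hlt
      refine hspan ?_
      obtain ⟨u, rfl⟩ := hu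
      rw [Fin.sum_univ_castSucc, hue, ← eq_neg_iff_add_eq_zero] at hr
      have : π ^ (c k - 1) • y (Fin.last k) =
          (-(↑u⁻¹ : R) * π ^ (c k - 1 - e)) • ∑ j : Fin k, r j.castSucc • y j.castSucc := by
        rw [hr, smul_neg, ← neg_smul, smul_smul]
        congr 1
        simp only [neg_mul, neg_neg]
        rw [mul_mul_mul_comm, Units.inv_mul, one_mul, ← pow_add]
        congr 1
        omega
      rw [this]
      exact Submodule.smul_mem _ _ (Submodule.sum_mem _ fun j _ =>
        Submodule.smul_mem _ _ (Submodule.subset_span ⟨j, rfl⟩))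
    have hzero : π ^ c k ∣ r (Fin.last k) → r (Fin.last k) • y (Fin.last k) = 0 := by
      rintro ⟨t, ht⟩
      rw [ht, mul_comm, mul_smul, h0, smul_zero]
    rw [Fin.forall_fin_succ']
    have hinit := h (fun j => r j.castSucc)
    simp only [Fin.init] at hinit
    constructor
    · intro hr
      have hl := hlast hr
      rw [Fin.sum_univ_castSucc, hzero hl, add_zero] at hr
      exact ⟨hinit.1 hr, hl⟩
    · rintro ⟨h1, h2⟩
      rw [Fin.sum_univ_castSucc, hzero h2, add_zero]
      exact hinit.2 h1

/-- The socle of the span of an independent tuple: its elements are divisible, and it has `q ^ k`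
elements. -/
lemma card_span_inf_torsionBy (hR : IsFiniteChainRing R q s π) {c : ℕ → ℕ} {k : ℕ}
    (hc : ∀ j < k, 1 ≤ c j) (hcs : ∀ j < k, c j ≤ s) {y : Fin k → M} (hy : IndepOfType π c y) :
    (∀ e : ℕ, (∀ j < k, e ≤ c j) → 1 ≤ e → ∀ w ∈ Submodule.span R (Set.range y), π • w = 0 →
      ∃ x : M, π ^ e • x = 0 ∧ π ^ (e - 1) • x = w) ∧
    Nat.card ↥(Submodule.span R (Set.range y) ⊓ Submodule.torsionBy R M π) = q ^ k := by
  have hmem : ∀ w ∈ Submodule.span R (Set.range y), π • w = 0 →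
      ∃ t : Fin k → R, w = ∑ j, (t j * π ^ (c j - 1)) • y j := by
    intro w hw hπ
    obtain ⟨r, rfl⟩ := (Submodule.mem_span_range_iff_exists_fun R).1 hw
    simp_rw [Finset.smul_sum, smul_smul] at hπ
    have hr := (hy _).1 hπ
    have (j : Fin k) : π ^ (c j - 1) ∣ r j := by
      refine hR.pow_dvd_of_pow_add_dvd (e := 1) ?_ ?_
      · have := hc j j.2; have := hcs j j.2; omega
      · rw [Nat.sub_add_cancel (hc j j.2), pow_one]; exact hr j
    choose t ht using this
    exact ⟨t, Finset.sum_congr rfl fun j _ => by rw [ht, mul_comm]⟩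
  have hkill (j : Fin k) : π ^ c j • y j = 0 := by
    have := (hy (Pi.single j (π ^ c j))).2 fun i => by
      rcases eq_or_ne i j with rfl | h
      · simp
      · simp [h]
    simpa [Pi.single_apply, ite_smul] using this
  refine ⟨fun e he he1 w hw hπ => ?_, ?_⟩
  · obtain ⟨t, rfl⟩ := hmem w hw hπ
    refine ⟨∑ j, (t j * π ^ (c j - e)) • y j, ?_, ?_⟩
    · rw [Finset.smul_sum]
      refine Finset.sum_eq_zero fun j _ => ?_
      rw [smul_smul, mul_left_comm, ← pow_add, Nat.add_sub_cancel' (he j j.2), mul_smul, hkill,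
        smul_zero]
    · rw [Finset.smul_sum]
      refine Finset.sum_congr rfl fun j _ => ?_
      rw [smul_smul, mul_left_comm, ← pow_add]
      congr 3
      have := he j j.2
      omega
  · set g : (Fin k → R) →ₗ[R] M := Fintype.linearCombination R fun j => π ^ (c j - 1) • y j with hg
    have hgt (t : Fin k → R) : g t = ∑ j, (t j * π ^ (c j - 1)) • y j := by
      simp [hg, Fintype.linearCombination_apply, smul_smul]
    have hrange : LinearMap.range g =
        Submodule.span R (Set.range y) ⊓ Submodule.torsionBy R M π := by
      ext w
      simp only [LinearMap.mem_range, Submodule.mem_inf, Submodule.mem_torsionBy_iff]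
      constructor
      · rintro ⟨t, rfl⟩
        rw [hgt]
        refine ⟨Submodule.sum_mem _ fun j _ =>
          Submodule.smul_mem _ _ (Submodule.subset_span ⟨j, rfl⟩), ?_⟩
        rw [Finset.smul_sum]
        refine Finset.sum_eq_zero fun j _ => ?_
        rw [smul_smul, mul_left_comm, ← pow_succ', Nat.sub_add_cancel (hc j j.2), mul_smul, hkill,
          smul_zero]
      · rintro ⟨hw, hπ⟩
        obtain ⟨t, rfl⟩ := hmem w hw hπ
        exact ⟨t, hgt t⟩
    -- The kernel consists of the tuples with all entries in ⟨π⟩, so the image has (|R| / |⟨π⟩|)^k =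
    -- q^k elements.
    have hker : Nat.card (LinearMap.ker g) = Nat.card (Ideal.span {π}) ^ k := by
      have : Nat.card (LinearMap.ker g) = Nat.card (Fin k → Ideal.span {π}) := by
        have hiff (t : Fin k → R) : t ∈ LinearMap.ker g ↔ ∀ j, t j ∈ Ideal.span {π} := by
          rw [LinearMap.mem_ker, hgt, hy]
          refine forall_congr' fun j => ?_
          rw [Ideal.mem_span_singleton]
          have h1 := hc j j.2
          have h2 := hcs j j.2
          constructor
          · intro h
            have := hR.pow_dvd_of_pow_add_dvd (i := 1) (e := c j - 1) (r := t j) (by omega)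
              (by rwa [Nat.add_sub_cancel' h1, mul_comm])
            simpa using this
          · rintro ⟨a, ha⟩
            refine ⟨a, ?_⟩
            rw [ha, mul_right_comm, ← pow_succ', Nat.sub_add_cancel h1]
        exact Nat.card_congr
          ⟨fun t j => ⟨t.1 j, (hiff t.1).1 t.2 j⟩, fun t => ⟨fun j => t j, (hiff _).2 fun j => (t j).2⟩,
            fun _ => rfl, fun _ => rfl⟩
      rw [this, Nat.card_fun, Nat.card_fin]
    have hcard := card_ker_mul_card_range g
    rw [hker, Nat.card_fun, Nat.card_fin, hR.card_eq_mul_card_span, mul_pow, mul_comm (q ^ k)] at hcard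
    rw [← hrange]
    exact Nat.eq_of_mul_eq_mul_left (pow_pos Nat.card_pos k) hcard

/-- Among the x killed by π^{c_k}, the bad ones are those that π^{c_k-1} sends into the socle of the
span. Since c_k ≤ c_j for the earlier j, every socle element is hit. The bad set is thus a union of
q^k cosets of the π^{c_k-1}-torsion. -/
lemma card_extensions (hR : IsFiniteChainRing R q s π) [Finite M] {c : ℕ → ℕ} {k : ℕ}
    (hc : ∀ j ≤ k, 1 ≤ c j) (hcs : ∀ j ≤ k, c j ≤ s) (hanti : ∀ j < k, c k ≤ c j)
    {y : Fin k → M} (hy : IndepOfType π c y) :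
    (Nat.card {x : M // π ^ c k • x = 0 ∧
      π ^ (c k - 1) • x ∉ Submodule.span R (Set.range y)} : ℝ) =
      Nat.card (Submodule.torsionBy R M (π ^ c k)) -
        (q : ℝ) ^ k * Nat.card (Submodule.torsionBy R M (π ^ (c k - 1))) := by
  classical
  obtain ⟨hdiv, hcard⟩ := card_span_inf_torsionBy hR (fun j hj => hc j hj.le)
    (fun j hj => hcs j hj.le) hy
  set S := Submodule.span R (Set.range y)
  have hbad := card_comap_of_le_range (LinearMap.lsmul R M (π ^ (c k - 1)))
    (W := S ⊓ Submodule.torsionBy R M π) (by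
      rintro w ⟨hw, hπ⟩
      obtain ⟨x, -, hx⟩ := hdiv (c k) hanti (hc k le_rfl) w hw hπ
      exact ⟨x, hx⟩)
  rw [hcard] at hbad
  have hker : LinearMap.ker (LinearMap.lsmul R M (π ^ (c k - 1))) =
    Submodule.torsionBy R M (π ^ (c k - 1)) := rfl
  rw [hker] at hbad
  have hsplit : Nat.card (Submodule.torsionBy R M (π ^ c k)) =
      Nat.card (Submodule.comap (LinearMap.lsmul R M (π ^ (c k - 1)))
        (S ⊓ Submodule.torsionBy R M π)) +
      Nat.card {x : M // π ^ c k • x = 0 ∧ π ^ (c k - 1) • x ∉ S} := by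
    have hpow (x : M) : π • π ^ (c k - 1) • x = π ^ c k • x := by
      rw [smul_smul, ← pow_succ', Nat.sub_add_cancel (hc k le_rfl)]
    have hunion : ((Submodule.torsionBy R M (π ^ c k) : Submodule R M) : Set M) =
        ((Submodule.comap (LinearMap.lsmul R M (π ^ (c k - 1)))
          (S ⊓ Submodule.torsionBy R M π) : Submodule R M) : Set M) ∪
        {x : M | π ^ c k • x = 0 ∧ π ^ (c k - 1) • x ∉ S} := by
      ext x
      simp only [SetLike.mem_coe, Submodule.mem_torsionBy_iff, Set.mem_union, Submodule.mem_comap,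
        Submodule.mem_inf, LinearMap.lsmul_apply, hpow, Set.mem_ofPred_eq]
      tauto
    have hdisj : Disjoint ((Submodule.comap (LinearMap.lsmul R M (π ^ (c k - 1)))
          (S ⊓ Submodule.torsionBy R M π) : Submodule R M) : Set M)
        {x : M | π ^ c k • x = 0 ∧ π ^ (c k - 1) • x ∉ S} := by
      rw [Set.disjoint_left]
      exact fun x hx hx' => hx'.2 hx.1
    have := Set.ncard_union_eq hdisj (Set.toFinite _) (Set.toFinite _)
    rw [← hunion] at this
    exact this
  rw [hsplit, hbad]
  push_cast
  ring

lemma card_indepOfType (hR : IsFiniteChainRing R q s π) [Finite M] {c : ℕ → ℕ} {k : ℕ}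
    (hc : ∀ j < k, 1 ≤ c j) (hcs : ∀ j < k, c j ≤ s) (hanti : ∀ i j, i ≤ j → j < k → c j ≤ c i) :
    (Nat.card {y : Fin k → M // IndepOfType π c y} : ℝ) =
      ∏ j ∈ Finset.range k, ((Nat.card (Submodule.torsionBy R M (π ^ c j)) : ℝ) -
        (q : ℝ) ^ j * Nat.card (Submodule.torsionBy R M (π ^ (c j - 1)))) := by
  induction k with
  | zero =>
    have : Unique {y : Fin 0 → M // IndepOfType π c y} :=
      { default := ⟨Fin.elim0, fun r => by simp⟩
        uniq := fun y => Subtype.ext (Subsingleton.elim _ _) }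
    simp
  | succ k ih =>
    have ih := ih (fun j hj => hc j (by omega)) (fun j hj => hcs j (by omega))
      (fun i j hij hj => hanti i j hij (by omega))
    have e : {y : Fin (k + 1) → M // IndepOfType π c y} ≃
        (Σ y : {y : Fin k → M // IndepOfType π c y}, {x : M // π ^ c k • x = 0 ∧
          π ^ (c k - 1) • x ∉ Submodule.span R (Set.range y.1)}) :=
      { toFun := fun y =>
          have h := (indepOfType_succ_iff hR (hc k k.lt_succ_self) (hcs k k.lt_succ_self) y.1).1 y.2
          ⟨⟨Fin.init y.1, h.1⟩, ⟨y.1 (Fin.last k), h.2⟩⟩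
        invFun := fun y => ⟨Fin.snoc (α := fun _ => M) y.1.1 y.2.1,
          (indepOfType_succ_iff hR (hc k k.lt_succ_self) (hcs k k.lt_succ_self) _).2 (by
            rw [Fin.init_snoc, Fin.snoc_last]
            exact ⟨y.1.2, y.2.2⟩)⟩
        left_inv := fun y => Subtype.ext (Fin.snoc_init_self y.1)
        right_inv := fun y => Sigma.subtype_ext (Subtype.ext (Fin.init_snoc (α := fun _ => M) _ _))
          (Fin.snoc_last (α := fun _ => M) _ _) }
    have := Fintype.ofFinite {y : Fin k → M // IndepOfType π c y}
    rw [Nat.card_congr e, Nat.card_sigma, Nat.cast_sum, Finset.prod_range_succ, ← ih]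
    rw [Finset.sum_congr rfl fun y _ => card_extensions hR (fun j hj => hc j (by omega))
      (fun j hj => hcs j (by omega)) (fun j hj => hanti j k hj.le k.lt_succ_self) y.2]
    rw [Finset.sum_const, Finset.card_univ, nsmul_eq_mul, ← Nat.card_eq_fintype_card]

end IndepOfType

/-! ### Generating tuples, by reduction modulo π -/

lemma card_span_eq_top_tuples {F : Type*} [Field F] [Finite F] {n k : ℕ} (hk : k ≤ n) :
    Nat.card {w : Fin n → Fin k → F // Submodule.span F (Set.range w) = ⊤} =
      ∏ i ∈ Finset.range k, (Nat.card F ^ n - Nat.card F ^ i) := by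
  have := Fintype.ofFinite F
  have h := card_linearIndependent (K := F) (V := Fin n → F) (k := k) (by simpa using hk)
  rw [Module.finrank_fin_fun, Fin.prod_univ_eq_prod_range
    (fun i => Fintype.card F ^ n - Fintype.card F ^ i)] at h
  rw [Nat.card_eq_fintype_card (α := F), ← h]
  -- Transposition: since row rank equals column rank, the n rows span F^k exactly when the k
  -- columns in F^n are independent.
  refine Nat.card_congr ((Equiv.piComm fun _ _ => F).subtypeEquiv fun w => ?_)
  rw [linearIndependent_iff_card_eq_finrank_span, Set.finrank]
  have h1 := (Matrix.of w).rank_eq_finrank_span_row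
  have h2 := (Matrix.of w).rank_eq_finrank_span_cols
  have h3 : Set.range (Matrix.of w).row = Set.range w := rfl
  have h4 : Set.range (Matrix.of w).col = Set.range ((Equiv.piComm fun _ _ => F) w) := rfl
  rw [h3] at h1
  rw [h4] at h2
  rw [← h2, h1, Fintype.card_fin]
  constructor
  · intro h
    rw [h, finrank_top, Module.finrank_fin_fun]
  · intro h
    exact Submodule.eq_top_of_finrank_eq (by rw [← h, Module.finrank_fin_fun])

namespace IsFiniteChainRing

variable {R : Type*} [CommRing R] [Finite R] {q s : ℕ} {π : R}

lemma span_le_jacobson_bot (hR : IsFiniteChainRing R q s π) :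
    Ideal.span {π} ≤ (⊥ : Ideal R).jacobson := by
  rw [Ideal.span_singleton_le_iff_mem, Ideal.mem_jacobson_bot]
  intro y
  refine IsNilpotent.isUnit_add_one ⟨s, ?_⟩
  rw [mul_pow, hR.pow_eq_zero, zero_mul]

/-- Nakayama: π lies in the Jacobson radical, so generation is detected modulo π. -/
lemma span_range_mk_eq_top_iff (hR : IsFiniteChainRing R q s π) {n k : ℕ}
    (B : Fin n → Fin k → R) :
    Submodule.span (R ⧸ Ideal.span {π})
        (Set.range fun i j => Ideal.Quotient.mk (Ideal.span {π}) (B i j)) = ⊤ ↔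
      Submodule.span R (Set.range B) = ⊤ := by
  set I := Ideal.span {π}
  let Q : (Fin k → R) →ₗ[R] (Fin k → R ⧸ I) := LinearMap.compLeft (Ideal.Quotient.mkₐ R I).toLinearMap (Fin k)
  have hQ : Function.Surjective Q := fun v =>
    ⟨fun j => (Ideal.Quotient.mk_surjective (v j)).choose,
      funext fun j => (Ideal.Quotient.mk_surjective (v j)).choose_spec⟩
  have hrange : (Set.range fun i j => Ideal.Quotient.mk I (B i j)) = Q '' Set.range B := by
    rw [← Set.range_comp]
    rfl
  rw [← Submodule.restrictScalars_eq_top_iff R,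
    Submodule.restrictScalars_span R (R ⧸ I) Ideal.Quotient.mk_surjective, hrange,
    Submodule.span_image]
  constructor
  · intro h
    refine top_le_iff.1 (Submodule.le_of_le_smul_of_le_jacobson_bot (I := I) Module.Finite.fg_top
      hR.span_le_jacobson_bot ?_)
    intro v _
    have hv : Q v ∈ Submodule.map Q (Submodule.span R (Set.range B)) := h ▸ Submodule.mem_top
    obtain ⟨w, hw, hwv⟩ := hv
    have hker : ∀ j, v j - w j ∈ I := fun j => by
      rw [← Ideal.Quotient.eq]
      exact (congrFun hwv j).symm
    choose t ht using fun j => Ideal.mem_span_singleton'.1 (hker j)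
    refine Submodule.mem_sup.2 ⟨w, hw, π • t, ?_, ?_⟩
    · exact Submodule.smul_mem_smul (Ideal.mem_span_singleton_self π) Submodule.mem_top
    · ext j
      have := ht j
      simp only [Pi.add_apply, Pi.smul_apply, smul_eq_mul]
      linear_combination this
  · intro h
    rw [h, Submodule.map_top, LinearMap.range_eq_top.2 hQ]

/-- The number of generating `n`-tuples of a module that is minimally generated by `k` elements. -/
lemma card_generating_tuples (hR : IsFiniteChainRing R q s π) {N : Type*} [AddCommGroup N]
    [Module R N] {n k : ℕ} (hk : k ≤ n) {D : (Fin k → R) →ₗ[R] N} (hD : Function.Surjective D)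
    (hker : ∀ r ∈ LinearMap.ker D, ∀ j, π ∣ r j) :
    Nat.card {w : Fin n → N // Submodule.span R (Set.range w) = ⊤} * q ^ (k * n) =
      (∏ i ∈ Finset.range k, (q ^ n - q ^ i)) * Nat.card N ^ n := by
  have : Finite (R ⧸ Ideal.span {π}) := Finite.of_surjective _ Ideal.Quotient.mk_surjective
  have := hR.maximal
  let F := Ideal.Quotient.field (Ideal.span {π})
  have hF := card_span_eq_top_tuples (F := R ⧸ Ideal.span {π}) hk
  rw [hR.card_residue] at hF
  let f : (Fin n → Fin k → R) →+ (Fin n → N) := (LinearMap.compLeft D (Fin n)).toAddMonoidHom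
  let g : (Fin n → Fin k → R) →+ (Fin n → Fin k → R ⧸ Ideal.span {π}) :=
    (LinearMap.compLeft (LinearMap.compLeft (Ideal.Quotient.mkₐ R (Ideal.span {π})).toLinearMap
      (Fin k)) (Fin n)).toAddMonoidHom
  have hf : Function.Surjective f := fun w =>
    ⟨fun i => (hD (w i)).choose, funext fun i => (hD (w i)).choose_spec⟩
  have hg : Function.Surjective g := fun w =>
    ⟨fun i j => (Ideal.Quotient.mk_surjective (w i j)).choose,
      funext fun i => funext fun j => (Ideal.Quotient.mk_surjective (w i j)).choose_spec⟩
  -- Lifted to n-tuples in R^k, generating N and spanning over the residue field are the same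
  -- condition. On the N side this is Nakayama again, because ker D lies in π R^k.
  have key := card_mul_card_of_preimage_eq f g hf hg
    (S := {w | Submodule.span R (Set.range w) = ⊤})
    (T := {w | Submodule.span (R ⧸ Ideal.span {π}) (Set.range w) = ⊤}) (by
      ext B
      have hT : B ∈ g ⁻¹' {w | Submodule.span (R ⧸ Ideal.span {π}) (Set.range w) = ⊤} ↔
        Submodule.span R (Set.range B) = ⊤ := hR.span_range_mk_eq_top_iff B
      rw [hT]
      have hS : Set.range (f B) = D '' Set.range B := by
        rw [← Set.range_comp]
        rfl
      rw [Set.mem_preimage, Set.mem_ofPred_eq, hS, Submodule.span_image]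
      constructor
      · intro h
        refine top_le_iff.1 (Submodule.le_of_le_smul_of_le_jacobson_bot (I := Ideal.span {π})
          Module.Finite.fg_top hR.span_le_jacobson_bot ?_)
        intro v _
        have hv : D v ∈ Submodule.map D (Submodule.span R (Set.range B)) := h ▸ Submodule.mem_top
        obtain ⟨w, hw, hwv⟩ := hv
        choose t ht using hker (v - w) (by rw [LinearMap.mem_ker, map_sub, hwv, sub_self])
        refine Submodule.mem_sup.2 ⟨w, hw, π • t, ?_, ?_⟩
        · exact Submodule.smul_mem_smul (Ideal.mem_span_singleton_self π) Submodule.mem_top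
        · ext j
          have := ht j
          simp only [Pi.add_apply, Pi.smul_apply, Pi.sub_apply, smul_eq_mul] at this ⊢
          linear_combination -this
      · intro h
        rw [h, Submodule.map_top, LinearMap.range_eq_top.2 hD])
  rw [Nat.card_fun, Nat.card_fun, Nat.card_fun, Nat.card_fin, Nat.card_fin, hR.card_residue,
    ← pow_mul] at key
  rw [← hF]
  exact key

end IsFiniteChainRing

/-! ### Double counting row tuples against independent tuples -/

lemma card_mul_eq_card_mul_of_rel {A B : Type*} [Finite A] [Finite B] {p : A → Prop} {p' : B → Prop}
    (r : A → B → Prop) {m n : ℕ} (hm : ∀ a, p a → Nat.card {b // p' b ∧ r a b} = m)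
    (hn : ∀ b, p' b → Nat.card {a // p a ∧ r a b} = n) :
    Nat.card {a // p a} * m = Nat.card {b // p' b} * n := by
  classical
  have := Fintype.ofFinite A
  have := Fintype.ofFinite B
  simp only [Nat.card_eq_fintype_card, Fintype.card_subtype] at *
  refine Finset.card_mul_eq_card_mul r (fun a ha => ?_) (fun b hb => ?_)
  · rw [Finset.bipartiteAbove, Finset.filter_filter]
    exact hm a (by simpa using ha)
  · rw [Finset.bipartiteBelow, Finset.filter_filter]
    exact hn b (by simpa using hb)

section

variable {R M N : Type*} [CommRing R] [AddCommGroup M] [Module R M] [AddCommGroup N] [Module R N]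

lemma card_tuples_span_eq_range {ι : Type*} {f : N →ₗ[R] M} (hf : Function.Injective f)
    (P : (ι → M) → Prop) :
    Nat.card {w : ι → M // P w ∧ Submodule.span R (Set.range w) = LinearMap.range f} =
      Nat.card {w : ι → N // P (f ∘ w) ∧ Submodule.span R (Set.range w) = ⊤} := by
  have hspan (w : ι → N) : Submodule.span R (Set.range (f ∘ w)) = LinearMap.range f ↔
      Submodule.span R (Set.range w) = ⊤ := by
    rw [Set.range_comp, Submodule.span_image, ← Submodule.map_top,
      (Submodule.map_injective_of_injective hf).eq_iff]
  symm
  refine Nat.card_congr (Equiv.ofBijective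
    (fun w => ⟨f ∘ w.1, w.2.1, (hspan w.1).2 w.2.2⟩) ⟨fun w w' h => ?_, ?_⟩)
  · exact Subtype.ext (hf.comp_left (congrArg Subtype.val h))
  · rintro ⟨w, hw, hws⟩
    have hmem (i : ι) : ∃ x, f x = w i := by
      rw [← LinearMap.mem_range, ← hws]
      exact Submodule.subset_span ⟨i, rfl⟩
    choose v hv using hmem
    obtain rfl : f ∘ v = w := funext hv
    exact ⟨⟨v, hw, (hspan v).1 hws⟩, rfl⟩

variable {π : R} {c : ℕ → ℕ} {k : ℕ}

lemma IndepOfType.mem_ker_iff {y : Fin k → M} (hy : IndepOfType π c y) (r : Fin k → R) :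
    r ∈ LinearMap.ker (Fintype.linearCombination R y) ↔ ∀ j : Fin k, π ^ c j ∣ r j := by
  rw [LinearMap.mem_ker, Fintype.linearCombination_apply]
  exact hy r

/-- The maps R^k → N and R^k → M given by the two tuples have the same kernel, which depends on c
alone; N is the quotient of R^k by it. -/
lemma IndepOfType.exists_injective {e : Fin k → N} {y : Fin k → M} (he : IndepOfType π c e)
    (hspan : Submodule.span R (Set.range e) = ⊤) (hy : IndepOfType π c y) :
    ∃ f : N →ₗ[R] M, Function.Injective f ∧
      LinearMap.range f = Submodule.span R (Set.range y) := by
  have hsurj : LinearMap.range (Fintype.linearCombination R e) = ⊤ := by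
    rw [Fintype.range_linearCombination, hspan]
  have hker : LinearMap.ker (Fintype.linearCombination R e) =
      LinearMap.ker (Fintype.linearCombination R y) := by
    ext r
    rw [he.mem_ker_iff, hy.mem_ker_iff]
  let φ := (Fintype.linearCombination R e).quotKerEquivOfSurjective (LinearMap.range_eq_top.1 hsurj)
  refine ⟨(Submodule.liftQ _ (Fintype.linearCombination R y) hker.le).comp φ.symm.toLinearMap,
    ?_, ?_⟩
  · rw [LinearMap.coe_comp]
    refine Function.Injective.comp ?_ φ.symm.injective
    rw [← LinearMap.ker_eq_bot, Submodule.ker_liftQ, ← hker, Submodule.mkQ_map_self]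
  · rw [LinearMap.range_comp, LinearEquiv.range, Submodule.map_top, Submodule.range_liftQ,
      Fintype.range_linearCombination]

/-- The tuple y defines an injective endomorphism of the finite module N, which is therefore
surjective. -/
lemma IndepOfType.span_eq_top [Finite N] {e y : Fin k → N} (he : IndepOfType π c e)
    (hspan : Submodule.span R (Set.range e) = ⊤) (hy : IndepOfType π c y) :
    Submodule.span R (Set.range y) = ⊤ := by
  obtain ⟨f, hf, hrange⟩ := he.exists_injective hspan hy
  rw [← hrange]
  exact LinearMap.range_eq_top.2 (Finite.injective_iff_surjective.1 hf)

/-- The number of `n`-tuples of `M` whose span is isomorphic to `N`, in terms of the numbers of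
independent tuples and of generating tuples. -/
lemma IndepOfType.card_tuples_mul [Finite M] [Finite N] {e : Fin k → N} (he : IndepOfType π c e)
    (hspan : Submodule.span R (Set.range e) = ⊤) (n : ℕ) :
    Nat.card {w : Fin n → M // Nonempty (Submodule.span R (Set.range w) ≃ₗ[R] N)} *
        Nat.card {y : Fin k → N // IndepOfType π c y} =
      Nat.card {y : Fin k → M // IndepOfType π c y} *
        Nat.card {w : Fin n → N // Submodule.span R (Set.range w) = ⊤} := by
  -- Relate w and y when their spans agree. As this common span is a copy of N, each w meets as many
  -- y as N has independent tuples, and each y meets as many w as N has generating n-tuples.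
  refine card_mul_eq_card_mul_of_rel
    (fun w y => Submodule.span R (Set.range y) = Submodule.span R (Set.range w)) ?_ ?_
  · rintro w ⟨ψ⟩
    have hf : Function.Injective ((Submodule.subtype _).comp ψ.symm.toLinearMap) :=
      Subtype.val_injective.comp ψ.symm.injective
    have hrange : LinearMap.range ((Submodule.subtype _).comp ψ.symm.toLinearMap) =
        Submodule.span R (Set.range w) := by
      rw [LinearMap.range_comp, LinearEquiv.range, Submodule.map_top, Submodule.range_subtype]
    have h := card_tuples_span_eq_range (ι := Fin k) hf (IndepOfType π c)
    rw [hrange] at h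
    rw [h]
    refine Nat.card_congr (Equiv.subtypeEquivRight fun y => ?_)
    rw [indepOfType_comp_iff hf, and_iff_left_iff_imp]
    exact he.span_eq_top hspan
  · intro y hy
    obtain ⟨f, hf, hrange⟩ := he.exists_injective hspan hy
    have h := card_tuples_span_eq_range (ι := Fin n) hf (fun _ => True)
    simp only [true_and, hrange] at h
    rw [← h]
    refine Nat.card_congr (Equiv.subtypeEquivRight fun w => ?_)
    constructor
    · exact fun h => h.2.symm
    · refine fun h => ⟨⟨?_⟩, h.symm⟩
      rw [h, ← hrange]
      exact (LinearEquiv.ofInjective f hf).symm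

end

/-! ### Combinatorics of shapes: parts versus coordinate levels -/

namespace Shape

variable {s : ℕ}

lemma component_zero (μ : Shape s) : μ 0 = 0 := by simp [component]

lemma component_mono (μ : Shape s) {i j : ℕ} (hij : i ≤ j) (hj : j ≤ s) : μ i ≤ μ j := by
  rcases Nat.eq_zero_or_pos i with rfl | hi
  · rw [component_zero]
    exact Nat.zero_le _
  · rw [component, component, dif_pos ⟨hi, hij.trans hj⟩, dif_pos ⟨hi.trans_le hij, hj⟩]
    exact μ.mono (Fin.mk_le_mk.2 (by omega))

/-- The largest `l ≤ s` with `μ l ≤ j`: the coordinate `j` of `R^μ` ranges over `⟨π ^ l⟩`. -/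
def level (μ : Shape s) (j : ℕ) : ℕ := Nat.findGreatest (fun l => μ l ≤ j) s

lemma le_level_iff (μ : Shape s) {i : ℕ} (hi : i ≤ s) (j : ℕ) : i ≤ μ.level j ↔ μ i ≤ j := by
  constructor
  · intro h
    refine (μ.component_mono h (Nat.findGreatest_le s)).trans ?_
    exact Nat.findGreatest_spec (P := fun l => μ l ≤ j) s.zero_le (by simp [component_zero])
  · exact fun h => Nat.le_findGreatest (P := fun l => μ l ≤ j) hi h

lemma level_lt_iff (μ : Shape s) {i : ℕ} (hi : i ≤ s) (j : ℕ) : μ.level j < i ↔ j < μ i := by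
  rw [← not_le, le_level_iff μ hi, not_le]

lemma level_lt (μ : Shape s) {j : ℕ} (hj : j < μ s) : μ.level j < s :=
  (μ.level_lt_iff le_rfl j).2 hj

lemma level_le_level (μ : Shape s) {i j : ℕ} (hij : i ≤ j) : μ.level i ≤ μ.level j :=
  (μ.le_level_iff (Nat.findGreatest_le s) j).2
    (((μ.le_level_iff (Nat.findGreatest_le s) i).1 le_rfl).trans hij)

lemma level_eq_iff (μ : Shape s) {l : ℕ} (hl : l < s) (j : ℕ) :
    μ.level j = l ↔ μ l ≤ j ∧ j < μ (l + 1) := by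
  rw [← le_level_iff μ hl.le, ← level_lt_iff μ hl]
  omega

/-- Exchange the sums: exactly μ_i indices j satisfy j < μ_i. This turns exponents collected
coordinate by coordinate into sums over the parts. -/
lemma sum_range_sum_filter (μ : Shape s) (A : Finset ℕ) (hA : ∀ i ∈ A, i ≤ s) (g : ℕ → ℕ) :
    ∑ j ∈ Finset.range (μ s), ∑ i ∈ A with j < μ i, g i = ∑ i ∈ A, μ i * g i := by
  simp_rw [Finset.sum_filter]
  rw [Finset.sum_comm]
  refine Finset.sum_congr rfl fun i hi => ?_
  rw [← Finset.sum_filter, Finset.sum_const, smul_eq_mul]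
  congr 1
  have : {j ∈ Finset.range (μ s) | j < μ i} = Finset.range (μ i) := by
    ext j
    have := μ.component_mono (hA i hi) le_rfl
    simp only [Finset.mem_filter, Finset.mem_range]
    omega
  rw [this, Finset.card_range]

lemma filter_lt_component (μ : Shape s) (a j : ℕ) :
    {i ∈ Finset.Ioc a s | j < μ i} = Finset.Ioc (max (μ.level j) a) s := by
  ext i
  simp only [Finset.mem_filter, Finset.mem_Ioc, max_lt_iff]
  constructor
  · rintro ⟨⟨h1, h2⟩, h3⟩
    exact ⟨⟨(μ.level_lt_iff h2 j).2 h3, h1⟩, h2⟩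
  · rintro ⟨⟨h1, h2⟩, h3⟩
    exact ⟨⟨h2, h3⟩, (μ.level_lt_iff h3 j).1 h1⟩

lemma size_eq_sum_Ioc (μ : Shape s) : μ.size = ∑ i ∈ Finset.Ioc 0 s, μ i := rfl

end Shape

/-! ### Cardinalities attached to R^μ, and the number of matrices of shape τ -/

section ShapeModule

variable {R : Type*} [CommRing R] {s : ℕ} {π : R}

lemma mem_shapeModule_iff {μ : Shape s} {v : Fin (μ s) → R} :
    v ∈ shapeModule π μ ↔ ∀ j : Fin (μ s), π ^ μ.level j ∣ v j := by
  simp_rw [← Ideal.mem_span_singleton]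
  refine forall_congr' fun j => ⟨fun h => ?_, fun h l hl h1 h2 => ?_⟩
  · have hl := μ.level_lt j.2
    obtain ⟨h1, h2⟩ := (μ.level_eq_iff hl j).1 rfl
    exact h _ hl h1 h2
  · rwa [(μ.level_eq_iff hl j).2 ⟨h1, h2⟩] at h

/-- The generators `π ^ l • e_j` of `R^μ`. -/
def shapeModuleGen (π : R) (μ : Shape s) (j : Fin (μ s)) : shapeModule π μ :=
  ⟨Pi.single j (π ^ μ.level j), mem_shapeModule_iff.2 fun i => by
    rcases eq_or_ne i j with rfl | h
    · simp
    · simp [h]⟩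

lemma sum_smul_shapeModuleGen {μ : Shape s} (r : Fin (μ s) → R) (i : Fin (μ s)) :
    (∑ j, r j • shapeModuleGen π μ j : shapeModule π μ).1 i = r i * π ^ μ.level i := by
  simp [shapeModuleGen, Finset.sum_apply, Pi.single_apply]

lemma span_shapeModuleGen (π : R) (μ : Shape s) :
    Submodule.span R (Set.range (shapeModuleGen π μ)) = ⊤ := by
  refine top_le_iff.1 fun v _ => ?_
  choose r hr using mem_shapeModule_iff.1 v.2
  refine (Submodule.mem_span_range_iff_exists_fun R).2 ⟨r, Subtype.ext (funext fun i => ?_)⟩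
  rw [sum_smul_shapeModuleGen, hr, mul_comm]

/-- `R^{n × μ}` as a set of `n`-tuples in `R^μ`. -/
def matrixModuleEquiv (π : R) (n : ℕ) (μ : Shape s) :
    matrixModule π n μ ≃ (Fin n → shapeModule π μ) where
  toFun A i := ⟨A.1.row i, A.2 i⟩
  invFun w := ⟨Matrix.of fun i => (w i).1, fun i => (w i).2⟩
  left_inv _ := rfl
  right_inv _ := rfl

lemma card_matricesOfShape_eq (n : ℕ) (μ τ : Shape s) :
    Nat.card (matricesOfShape π n μ τ) = Nat.card {w : Fin n → shapeModule π μ //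
      Nonempty (Submodule.span R (Set.range w) ≃ₗ[R] shapeModule π τ)} := by
  refine Nat.card_congr ((matrixModuleEquiv π n μ).subtypeEquiv fun A => ?_)
  have h : rowSpan A.1 = Submodule.map (shapeModule π μ).subtype
      (Submodule.span R (Set.range (matrixModuleEquiv π n μ A))) := by
    rw [← Submodule.span_image, ← Set.range_comp]
    rfl
  let ψ := Submodule.equivMapOfInjective (shapeModule π μ).subtype
    (Submodule.injective_subtype _) (Submodule.span R (Set.range (matrixModuleEquiv π n μ A)))
  change Nonempty (rowSpan A.1 ≃ₗ[R] shapeModule π τ) ↔ _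
  rw [h]
  exact ⟨fun ⟨φ⟩ => ⟨ψ.trans φ⟩, fun ⟨φ⟩ => ⟨ψ.symm.trans φ⟩⟩

variable [Finite R] {q : ℕ}

lemma indepOfType_shapeModuleGen (hR : IsFiniteChainRing R q s π) (μ : Shape s) :
    IndepOfType π (fun j => s - μ.level j) (shapeModuleGen π μ) := by
  intro r
  rw [Subtype.ext_iff, funext_iff]
  refine forall_congr' fun i => ?_
  rw [sum_smul_shapeModuleGen, mul_comm]
  exact hR.pow_mul_eq_zero_iff (μ.level_lt i.2).le

/-- Being killed by π^e means being divisible by π^{s-e}, so coordinate j ranges freely over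
⟨π^{max(level j, s-e)}⟩; the exponents are then regrouped by parts. -/
lemma card_torsionBy_shapeModule (hR : IsFiniteChainRing R q s π) (μ : Shape s) {e : ℕ}
    (he : e ≤ s) :
    Nat.card (Submodule.torsionBy R (shapeModule π μ) (π ^ e)) =
      q ^ ∑ i ∈ Finset.Ioc (s - e) s, μ i := by
  have hiff (v : Fin (μ s) → R) : (v ∈ shapeModule π μ ∧ π ^ e • v = 0) ↔
      ∀ j : Fin (μ s), v j ∈ Ideal.span {π ^ max (μ.level j) (s - e)} := by
    rw [mem_shapeModule_iff, funext_iff, ← forall_and]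
    refine forall_congr' fun j => ?_
    rw [Pi.smul_apply, smul_eq_mul, Pi.zero_apply, hR.pow_mul_eq_zero_iff he,
      Ideal.mem_span_singleton]
    constructor
    · rintro ⟨h1, h2⟩
      rcases max_cases (μ.level j) (s - e) with h | h <;> rw [h.1] <;> assumption
    · exact fun h => ⟨(pow_dvd_pow π (le_max_left _ _)).trans h,
        (pow_dvd_pow π (le_max_right _ _)).trans h⟩
  have E : Submodule.torsionBy R (shapeModule π μ) (π ^ e) ≃
      ((j : Fin (μ s)) → Ideal.span {π ^ max (μ.level j) (s - e)}) :=
    { toFun := fun v j => ⟨v.1.1 j, (hiff v.1.1).1 ⟨v.1.2, congrArg Subtype.val v.2⟩ j⟩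
      invFun := fun v => ⟨⟨fun j => v j, ((hiff _).2 fun j => (v j).2).1⟩,
        Subtype.ext ((hiff _).2 fun j => (v j).2).2⟩
      left_inv := fun _ => rfl
      right_inv := fun _ => rfl }
  rw [Nat.card_congr E, Nat.card_pi, Finset.prod_congr rfl fun j _ => hR.card_span_pow
    (max_le (μ.level_lt j.2).le (Nat.sub_le s e)), Finset.prod_pow_eq_pow_sum]
  congr 1
  rw [Fin.sum_univ_eq_sum_range (fun j => s - max (μ.level j) (s - e))]
  have h := μ.sum_range_sum_filter (Finset.Ioc (s - e) s) (fun i hi => (Finset.mem_Ioc.1 hi).2) 1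
  simp_rw [Shape.filter_lt_component, Pi.one_apply, mul_one, Finset.sum_const, Nat.card_Ioc,
    smul_eq_mul, mul_one] at h
  exact h

lemma card_shapeModule (hR : IsFiniteChainRing R q s π) (μ : Shape s) :
    Nat.card (shapeModule π μ) = q ^ μ.size := by
  have h := card_torsionBy_shapeModule hR μ le_rfl
  rw [hR.pow_eq_zero, Nat.sub_self] at h
  rw [μ.size_eq_sum_Ioc, ← h]
  have : Submodule.torsionBy R (shapeModule π μ) (0 : R) = ⊤ :=
    top_le_iff.1 fun v _ => by simp
  rw [this, Nat.card_congr Submodule.topEquiv.toEquiv]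

lemma card_matrixModule (hR : IsFiniteChainRing R q s π) (n : ℕ) (μ : Shape s) :
    Nat.card (matrixModule π n μ) = q ^ (n * μ.size) := by
  rw [Nat.card_congr (matrixModuleEquiv π n μ), Nat.card_fun, Nat.card_fin, card_shapeModule hR,
    ← pow_mul, mul_comm]

/-- The correction factor in the number of embeddings of `R^τ` into `R^μ`. -/
noncomputable def embeddingFactor (q : ℕ) (τ μ : Shape s) : ℝ :=
  ∏ j ∈ Finset.range (τ s), (1 - (q : ℝ) ^ ((j : ℤ) - (μ (τ.level j + 1) : ℤ)))

/-- With l the level of j in τ, the number of choices for vector j is q^{Σ_{i>l} μ_i} - q^j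
q^{Σ_{i>l+1} μ_i}. Extracting the first power leaves 1 - q^{j-μ_{l+1}}. -/
lemma card_indepOfType_shapeModule (hR : IsFiniteChainRing R q s π) (τ μ : Shape s) :
    (Nat.card {y : Fin (τ s) → shapeModule π μ //
        IndepOfType π (fun j => s - τ.level j) y} : ℝ) =
      (q : ℝ) ^ (∑ i ∈ Finset.Ioc 0 s, τ i * μ i) * embeddingFactor q τ μ := by
  have hq : (q : ℝ) ≠ 0 := by exact_mod_cast (zero_lt_one.trans hR.one_lt).ne'
  rw [card_indepOfType hR (fun j hj => by have := τ.level_lt hj; omega) (fun j _ => Nat.sub_le _ _)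
    (fun i j hij _ => Nat.sub_le_sub_left (τ.level_le_level hij) s)]
  have hterm (j : ℕ) (hj : j ∈ Finset.range (τ s)) :
      (Nat.card (Submodule.torsionBy R (shapeModule π μ) (π ^ (s - τ.level j))) : ℝ) -
        (q : ℝ) ^ j * Nat.card (Submodule.torsionBy R (shapeModule π μ)
          (π ^ (s - τ.level j - 1))) =
      (q : ℝ) ^ (∑ i ∈ Finset.Ioc 0 s with j < τ i, μ i) *
        (1 - (q : ℝ) ^ ((j : ℤ) - (μ (τ.level j + 1) : ℤ))) := by
    have hl := τ.level_lt (Finset.mem_range.1 hj)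
    rw [card_torsionBy_shapeModule hR μ (Nat.sub_le _ _),
      card_torsionBy_shapeModule hR μ ((Nat.sub_le _ _).trans (Nat.sub_le _ _)),
      Shape.filter_lt_component, Nat.max_zero]
    rw [show s - (s - τ.level j) = τ.level j by omega,
      show s - (s - τ.level j - 1) = τ.level j + 1 by omega,
      show Finset.Ioc (τ.level j) s = insert (τ.level j + 1) (Finset.Ioc (τ.level j + 1) s) by
        ext i; simp only [Finset.mem_Ioc, Finset.mem_insert]; omega,
      Finset.sum_insert (by simp), zpow_sub₀ hq, zpow_natCast, zpow_natCast]
    push_cast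
    rw [pow_add]
    field_simp
  rw [Finset.prod_congr rfl hterm, Finset.prod_mul_distrib, Finset.prod_pow_eq_pow_sum,
    τ.sum_range_sum_filter _ fun i hi => (Finset.mem_Ioc.1 hi).2]
  rfl

lemma card_generating_shapeModule (hR : IsFiniteChainRing R q s π) {n : ℕ} {τ : Shape s}
    (hn : τ s ≤ n) :
    (Nat.card {w : Fin n → shapeModule π τ // Submodule.span R (Set.range w) = ⊤} : ℝ) =
      (q : ℝ) ^ (n * τ.size) * fullRankFactor q n τ := by
  have hq : (q : ℝ) ≠ 0 := by exact_mod_cast (zero_lt_one.trans hR.one_lt).ne'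
  have hD : Function.Surjective (Fintype.linearCombination R (shapeModuleGen π τ)) := by
    rw [← LinearMap.range_eq_top, Fintype.range_linearCombination, span_shapeModuleGen]
  have h := hR.card_generating_tuples hn hD (fun r hr j => by
    refine dvd_trans ?_ (((indepOfType_shapeModuleGen hR τ).mem_ker_iff r).1 hr j)
    have := τ.level_lt j.2
    exact dvd_pow_self π (by omega))
  have h' := congrArg (Nat.cast (R := ℝ)) h
  rw [card_shapeModule hR] at h'
  push_cast at h'
  rw [Finset.prod_congr rfl (g := fun i : ℕ => (q : ℝ) ^ n * (1 - (q : ℝ) ^ ((i : ℤ) - (n : ℤ))))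
    (fun i hi => by
      rw [Nat.cast_sub (Nat.pow_le_pow_right (zero_lt_one.trans hR.one_lt)
        ((Finset.mem_range.1 hi).le.trans hn)), zpow_sub₀ hq, zpow_natCast, zpow_natCast]
      push_cast
      field_simp), Finset.prod_mul_distrib, Finset.prod_const, Finset.card_range] at h'
  refine mul_right_cancel₀ (pow_ne_zero (τ s * n) hq) (h'.trans ?_)
  rw [fullRankFactor]
  ring

lemma card_matricesOfShape_mul (hR : IsFiniteChainRing R q s π) {n : ℕ} {μ τ : Shape s}
    (hn : τ s ≤ n) :
    (Nat.card (matricesOfShape π n μ τ) : ℝ) *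
        ((q : ℝ) ^ (∑ i ∈ Finset.Ioc 0 s, τ i * τ i) * embeddingFactor q τ τ) =
      (q : ℝ) ^ (∑ i ∈ Finset.Ioc 0 s, τ i * μ i) * embeddingFactor q τ μ *
        ((q : ℝ) ^ (n * τ.size) * fullRankFactor q n τ) := by
  have h := (indepOfType_shapeModuleGen hR τ).card_tuples_mul (M := shapeModule π μ)
    (span_shapeModuleGen π τ) n
  rw [← card_matricesOfShape_eq] at h
  rw [← card_indepOfType_shapeModule hR τ τ, ← card_indepOfType_shapeModule hR τ μ,
    ← card_generating_shapeModule hR hn]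
  exact_mod_cast h

end ShapeModule

/-! ### Bounds for the correction products -/

lemma quarter_lt_prod_one_sub_pow (d : ℕ) :
    (1 / 4 : ℝ) < ∏ t ∈ Finset.range d, (1 - (1 / 2 : ℝ) ^ (t + 1)) := by
  rcases Nat.eq_zero_or_pos d with rfl | hd
  · norm_num
  -- The bound 1/4 alone is not inductive. The strengthened one is an equality at d = 1, and with x
  -- = 2^{-(d+1)} its step (1/4 + x)(1 - x) ≥ 1/4 + x/2 amounts to x ≤ 1/4.
  · refine lt_of_lt_of_le (b := 1 / 4 + (1 / 2 : ℝ) ^ (d + 1))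
      (lt_add_of_pos_right _ (by positivity)) ?_
    induction d, hd using Nat.le_induction with
    | base => norm_num
    | succ d hd ih =>
      rw [Finset.prod_range_succ]
      have h1 : (0 : ℝ) < (1 / 2) ^ (d + 1) := by positivity
      have h2 : (1 / 2 : ℝ) ^ (d + 1) ≤ 1 / 4 := by
        calc (1 / 2 : ℝ) ^ (d + 1) ≤ (1 / 2) ^ 2 :=
              pow_le_pow_of_le_one (by norm_num) (by norm_num) (by omega)
          _ = 1 / 4 := by norm_num
      calc (1 / 4 + (1 / 2 : ℝ) ^ (d + 1 + 1))
          ≤ (1 / 4 + (1 / 2) ^ (d + 1)) * (1 - (1 / 2) ^ (d + 1)) := by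
            rw [pow_succ]
            nlinarith
        _ ≤ _ := mul_le_mul_of_nonneg_right ih (by linarith)

lemma zpow_sub_lt_one {q : ℕ} (hq : 1 < q) {a b : ℕ} (h : a < b) :
    (q : ℝ) ^ ((a : ℤ) - (b : ℤ)) < 1 :=
  zpow_lt_one_of_neg₀ (by exact_mod_cast hq) (by omega)

lemma quarter_lt_prod_one_sub_zpow {q : ℕ} (hq : 1 < q) (d : ℕ) :
    (1 / 4 : ℝ) < ∏ j ∈ Finset.range d, (1 - (q : ℝ) ^ ((j : ℤ) - (d : ℤ))) := by
  refine (quarter_lt_prod_one_sub_pow d).trans_le ?_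
  rw [← Finset.prod_range_reflect]
  refine Finset.prod_le_prod (fun j _ => ?_) fun j hj => ?_
  · exact sub_nonneg.2 (pow_le_one₀ (by norm_num) (by norm_num))
  · have hj := Finset.mem_range.1 hj
    have hexp : (j : ℤ) - (d : ℤ) = -((d - 1 - j + 1 : ℕ) : ℤ) := by omega
    rw [hexp, zpow_neg, zpow_natCast, ← inv_pow]
    refine sub_le_sub_left (pow_le_pow_left₀ (by positivity) ?_ _) 1
    rw [one_div]
    exact inv_anti₀ (by norm_num) (by exact_mod_cast hq)

section

variable {q s n : ℕ} {τ μ : Shape s}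

lemma one_sub_zpow_le_one_sub_zpow (hq : 1 < q) {a b : ℕ} (h : a ≤ b) (j : ℕ) :
    1 - (q : ℝ) ^ ((j : ℤ) - (a : ℤ)) ≤ 1 - (q : ℝ) ^ ((j : ℤ) - (b : ℤ)) :=
  sub_le_sub_left (zpow_le_zpow_right₀ (by exact_mod_cast hq.le) (by omega)) 1

lemma one_sub_zpow_le_one (a b : ℤ) : 1 - (q : ℝ) ^ (a - b) ≤ 1 :=
  sub_le_self _ (by positivity)

lemma quarter_lt_fullRankFactor (hq : 1 < q) (hn : τ s ≤ n) : 1 / 4 < fullRankFactor q n τ :=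
  (quarter_lt_prod_one_sub_zpow hq (τ s)).trans_le <| Finset.prod_le_prod
    (fun _ hj => sub_nonneg.2 (zpow_sub_lt_one hq (Finset.mem_range.1 hj)).le)
    fun j _ => one_sub_zpow_le_one_sub_zpow hq hn j

lemma fullRankFactor_le_one (hq : 1 < q) (hn : τ s ≤ n) : fullRankFactor q n τ ≤ 1 :=
  Finset.prod_le_one (fun _ hj => sub_nonneg.2
    (zpow_sub_lt_one hq ((Finset.mem_range.1 hj).trans_le hn)).le) fun _ _ => one_sub_zpow_le_one _ _

lemma Shape.lt_component_level_succ {j : ℕ} (hj : j < τ s) : j < τ (τ.level j + 1) :=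
  (τ.level_lt_iff (τ.level_lt hj) j).1 (Nat.lt_succ_self _)

lemma Shape.IsSubshape.component_level_le (h : τ.IsSubshape μ) {j : ℕ} (hj : j < τ s) :
    τ (τ.level j + 1) ≤ μ (τ.level j + 1) :=
  h _ (Finset.mem_Icc.2 ⟨Nat.succ_pos _, τ.level_lt hj⟩)

lemma embeddingFactor_le_one (hq : 1 < q) (h : τ.IsSubshape μ) : embeddingFactor q τ μ ≤ 1 :=
  Finset.prod_le_one (fun _ hj => sub_nonneg.2 (zpow_sub_lt_one hq
    ((Shape.lt_component_level_succ (Finset.mem_range.1 hj)).trans_le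
      (h.component_level_le (Finset.mem_range.1 hj)))).le) fun _ _ => one_sub_zpow_le_one _ _

lemma embeddingFactor_self_le (hq : 1 < q) (h : τ.IsSubshape μ) :
    embeddingFactor q τ τ ≤ embeddingFactor q τ μ :=
  Finset.prod_le_prod (fun _ hj => sub_nonneg.2 (zpow_sub_lt_one hq
    (Shape.lt_component_level_succ (Finset.mem_range.1 hj))).le) fun j hj =>
      one_sub_zpow_le_one_sub_zpow hq (h.component_level_le (Finset.mem_range.1 hj)) j

lemma embeddingFactor_self_lt (hq : 1 < q) (h : τ.IsSubshape μ)
    (hex : ∃ i ∈ Finset.Icc 1 s, τ (i - 1) < τ i ∧ τ i < μ i) :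
    embeddingFactor q τ τ < embeddingFactor q τ μ := by
  obtain ⟨i, hi, h1, h2⟩ := hex
  obtain ⟨hi1, his⟩ := Finset.mem_Icc.1 hi
  have hlev : τ.level (τ (i - 1)) = i - 1 := by
    rw [τ.level_eq_iff (by omega), Nat.sub_add_cancel hi1]
    exact ⟨le_rfl, h1⟩
  -- The strict factor is at j = τ_{i-1}: its level is i - 1, so it compares τ_i with μ_i. For i = 1
  -- this uses τ_0 = 0.
  refine Finset.prod_lt_prod (fun _ hj => sub_pos.2 (zpow_sub_lt_one hq
    (Shape.lt_component_level_succ (Finset.mem_range.1 hj)))) (fun j hj =>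
      one_sub_zpow_le_one_sub_zpow hq (h.component_level_le (Finset.mem_range.1 hj)) j)
    ⟨τ (i - 1), Finset.mem_range.2 (h1.trans_le (τ.component_mono his le_rfl)), ?_⟩
  rw [hlev, Nat.sub_add_cancel hi1]
  exact sub_lt_sub_left (zpow_lt_zpow_right₀ (by exact_mod_cast hq) (by omega)) 1

/-- Group the factors by level. Those with level i - 1 are 1 - q^{j-τ_i} for some of the j < τ_i;
inserting the missing j only lowers the product, which still exceeds 1/4. There are s groups. -/
lemma quarter_pow_lt_embeddingFactor_self (hq : 1 < q) (hs : 0 < s) (τ : Shape s) :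
    (1 / 4 : ℝ) ^ s < embeddingFactor q τ τ := by
  have hmaps : ∀ j ∈ Finset.range (τ s), τ.level j + 1 ∈ Finset.Icc 1 s := fun j hj =>
    Finset.mem_Icc.2 ⟨Nat.succ_pos _, τ.level_lt (Finset.mem_range.1 hj)⟩
  rw [embeddingFactor, ← Finset.prod_fiberwise_of_maps_to hmaps,
    show (1 / 4 : ℝ) ^ s = ∏ _i ∈ Finset.Icc 1 s, (1 / 4 : ℝ) by simp]
  refine Finset.prod_lt_prod_of_nonempty (fun _ _ => by norm_num) (fun i hi => ?_)
    (Finset.nonempty_Icc.2 hs)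
  refine (quarter_lt_prod_one_sub_zpow hq (τ i)).trans_le ?_
  have hsub : {j ∈ Finset.range (τ s) | τ.level j + 1 = i} ⊆ Finset.range (τ i) := by
    intro j hj
    obtain ⟨h1, rfl⟩ := Finset.mem_filter.1 hj
    exact Finset.mem_range.2 (Shape.lt_component_level_succ (Finset.mem_range.1 h1))
  have hfib : ∏ j ∈ Finset.range (τ s) with τ.level j + 1 = i,
      (1 - (q : ℝ) ^ ((j : ℤ) - (τ (τ.level j + 1) : ℤ))) =
      ∏ j ∈ Finset.range (τ s) with τ.level j + 1 = i, (1 - (q : ℝ) ^ ((j : ℤ) - (τ i : ℤ))) :=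
    Finset.prod_congr rfl fun j hj => by rw [(Finset.mem_filter.1 hj).2]
  have hnonneg (j : ℕ) (hj : j ∈ Finset.range (τ i)) :
      0 ≤ 1 - (q : ℝ) ^ ((j : ℤ) - (τ i : ℤ)) :=
    sub_nonneg.2 (zpow_sub_lt_one hq (Finset.mem_range.1 hj)).le
  rw [hfib, ← Finset.prod_sdiff hsub]
  exact mul_le_of_le_one_left (Finset.prod_nonneg fun j hj => hnonneg j (hsub hj))
    (Finset.prod_le_one (fun j hj => hnonneg j (Finset.mem_sdiff.1 hj).1)
      fun _ _ => one_sub_zpow_le_one _ _)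

end

/-! ### Capacity of the additive matrix channel -/

section

variable {R : Type*} [CommRing R] [Finite R] {q s : ℕ} {π : R} {n : ℕ} {μ τ : Shape s}

lemma Shape.BoundedBy.component_le (hs : 0 < s) (hn : τ.BoundedBy n) : τ s ≤ n :=
  hn s (Finset.mem_Icc.2 ⟨hs, le_rfl⟩)

lemma embeddingFactor_self_pos (hR : IsFiniteChainRing R q s π) (τ : Shape s) :
    0 < embeddingFactor q τ τ :=
  lt_trans (by positivity) (quarter_pow_lt_embeddingFactor_self hR.one_lt hR.pos τ)

/-- Read off from the count: the side of the formula without |T_τ| is positive. -/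
lemma matricesOfShape_nonempty (hR : IsFiniteChainRing R q s π) (hn : τ.BoundedBy n)
    (h : τ.IsSubshape μ) : (matricesOfShape π n μ τ).Nonempty := by
  have hq : (0 : ℝ) < q := by exact_mod_cast zero_lt_one.trans hR.one_lt
  have key := card_matricesOfShape_mul hR (μ := μ) (hn.component_le hR.pos)
  by_contra hemp
  rw [Set.not_nonempty_iff_eq_empty] at hemp
  rw [hemp, Nat.card_eq_zero.2 (Or.inl inferInstance), Nat.cast_zero, zero_mul] at key
  have h1 := (embeddingFactor_self_pos hR τ).trans_le (embeddingFactor_self_le hR.one_lt h)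
  have h2 : 0 < fullRankFactor q n τ :=
    lt_trans (by norm_num) (quarter_lt_fullRankFactor hR.one_lt (hn.component_le hR.pos))
  exact absurd key (by positivity)

lemma logb_card_sub_logb_card (hR : IsFiniteChainRing R q s π) (hn : τ.BoundedBy n)
    (h : τ.IsSubshape μ) :
    Real.logb q (Nat.card (matrixModule π n μ)) - Real.logb q (Nat.card (matricesOfShape π n μ τ)) =
      ∑ i ∈ Finset.Icc 1 s, ((n : ℝ) - τ i) * ((μ i : ℝ) - τ i) -
        Real.logb q (fullRankFactor q n τ) -
        (Real.logb q (embeddingFactor q τ μ) - Real.logb q (embeddingFactor q τ τ)) := by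
  have hq1 : (1 : ℝ) < q := by exact_mod_cast hR.one_lt
  have hq : (0 : ℝ) < q := zero_lt_one.trans hq1
  have key := card_matricesOfShape_mul hR (μ := μ) (hn.component_le hR.pos)
  have hT : (Nat.card (matricesOfShape π n μ τ) : ℝ) ≠ 0 := by
    have := (matricesOfShape_nonempty hR hn h).to_subtype
    exact_mod_cast Nat.card_pos.ne'
  have h0 := embeddingFactor_self_pos hR τ
  have h1 := h0.trans_le (embeddingFactor_self_le hR.one_lt h)
  have h2 : 0 < fullRankFactor q n τ :=
    lt_trans (by norm_num) (quarter_lt_fullRankFactor hR.one_lt (hn.component_le hR.pos))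
  have hpow (a : ℕ) : Real.logb q ((q : ℝ) ^ a) = a := by
    rw [Real.logb_pow, Real.logb_self_eq_one hq1, mul_one]
  have hlog := congrArg (Real.logb q) key
  rw [Real.logb_mul hT (by positivity), Real.logb_mul (by positivity) h0.ne',
    Real.logb_mul (by positivity) (by positivity), Real.logb_mul (by positivity) h1.ne',
    Real.logb_mul (by positivity) h2.ne', hpow, hpow, hpow] at hlog
  rw [card_matrixModule hR, Nat.cast_pow, hpow]
  have hsum : ∑ i ∈ Finset.Icc 1 s, ((n : ℝ) - τ i) * ((μ i : ℝ) - τ i) =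
      (n * μ.size : ℕ) - (n * τ.size : ℕ) - (∑ i ∈ Finset.Ioc 0 s, τ i * μ i : ℕ) +
        (∑ i ∈ Finset.Ioc 0 s, τ i * τ i : ℕ) := by
    rw [μ.size_eq_sum_Ioc, τ.size_eq_sum_Ioc]
    push_cast
    rw [Finset.mul_sum, Finset.mul_sum, ← Finset.sum_sub_distrib, ← Finset.sum_sub_distrib,
      ← Finset.sum_add_distrib]
    exact Finset.sum_congr rfl fun i _ => by ring
  rw [hsum]
  linarith

lemma channelInformation_amc_le (hR : IsFiniteChainRing R q s π) (hn : τ.BoundedBy n)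
    (h : τ.IsSubshape μ) (p : stdSimplex ℝ (matrixModule π n μ)) :
    channelInformation q (amc π n μ τ) p ≤
      channelInformation q (amc π n μ τ) (uniformInput _) := by
  have hT := matricesOfShape_nonempty hR hn h
  rw [amc, channelInformation_uniformInput _ hT]
  exact channelInformation_additiveChannel_le (by exact_mod_cast hR.one_lt) hT p

lemma capacity_amc (hR : IsFiniteChainRing R q s π) (hn : τ.BoundedBy n) (h : τ.IsSubshape μ) :
    capacity q (amc π n μ τ) = Real.logb q (Nat.card (matrixModule π n μ)) -
      Real.logb q (Nat.card (matricesOfShape π n μ τ)) := by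
  rw [capacity_eq_of_forall_le (channelInformation_amc_le hR hn h), amc,
    channelInformation_uniformInput _ (matricesOfShape_nonempty hR hn h)]

lemma lt_capacity_amc (hR : IsFiniteChainRing R q s π) (hn : τ.BoundedBy n)
    (h : τ.IsSubshape μ) :
    ∑ i ∈ Finset.Icc 1 s, ((n : ℝ) - τ i) * ((μ i : ℝ) - τ i) -
      Real.logb q (4 ^ s * fullRankFactor q n τ) < capacity q (amc π n μ τ) := by
  have hq1 : (1 : ℝ) < q := by exact_mod_cast hR.one_lt
  have h0 := embeddingFactor_self_pos hR τ
  have h1 := h0.trans_le (embeddingFactor_self_le hR.one_lt h)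
  have h2 : 0 < fullRankFactor q n τ :=
    lt_trans (by norm_num) (quarter_lt_fullRankFactor hR.one_lt (hn.component_le hR.pos))
  have hlt := Real.logb_lt_logb hq1 (by positivity)
    (quarter_pow_lt_embeddingFactor_self hR.one_lt hR.pos τ)
  rw [one_div, inv_pow, Real.logb_inv] at hlt
  have hle := Real.logb_nonpos hq1 h1.le (embeddingFactor_le_one hR.one_lt h)
  rw [capacity_amc hR hn h, logb_card_sub_logb_card hR hn h,
    Real.logb_mul (by positivity) h2.ne']
  linarith

lemma capacity_amc_le (hR : IsFiniteChainRing R q s π) (hn : τ.BoundedBy n)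
    (h : τ.IsSubshape μ) :
    capacity q (amc π n μ τ) ≤ ∑ i ∈ Finset.Icc 1 s, ((n : ℝ) - τ i) * ((μ i : ℝ) - τ i) -
      Real.logb q (fullRankFactor q n τ) := by
  have := Real.logb_le_logb_of_le (b := q) (by exact_mod_cast hR.one_lt) (embeddingFactor_self_pos hR τ)
    (embeddingFactor_self_le hR.one_lt h)
  rw [capacity_amc hR hn h, logb_card_sub_logb_card hR hn h]
  linarith

lemma capacity_amc_lt (hR : IsFiniteChainRing R q s π) (hn : τ.BoundedBy n)
    (h : τ.IsSubshape μ) (hex : ∃ i ∈ Finset.Icc 1 s, τ (i - 1) < τ i ∧ τ i < μ i) :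
    capacity q (amc π n μ τ) < ∑ i ∈ Finset.Icc 1 s, ((n : ℝ) - τ i) * ((μ i : ℝ) - τ i) -
      Real.logb q (fullRankFactor q n τ) := by
  have := Real.logb_lt_logb (b := q) (by exact_mod_cast hR.one_lt) (embeddingFactor_self_pos hR τ)
    (embeddingFactor_self_lt hR.one_lt h hex)
  rw [capacity_amc hR hn h, logb_card_sub_logb_card hR hn h]
  linarith

/-- The bound depends only on q and s, which is what the asymptotic statement needs. -/
lemma abs_capacity_amc_sub_le (hR : IsFiniteChainRing R q s π) (hn : τ.BoundedBy n)
    (h : τ.IsSubshape μ) :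
    |capacity q (amc π n μ τ) - ∑ i ∈ Finset.Icc 1 s, ((n : ℝ) - τ i) * ((μ i : ℝ) - τ i)| ≤
      Real.logb q (4 ^ s) + Real.logb q 4 := by
  have hq1 : (1 : ℝ) < q := by exact_mod_cast hR.one_lt
  have hquarter := quarter_lt_fullRankFactor hR.one_lt (hn.component_le hR.pos)
  have hpos : 0 < fullRankFactor q n τ := lt_trans (by norm_num) hquarter
  have h1 := Real.logb_lt_logb hq1 (by norm_num) hquarter
  rw [one_div, Real.logb_inv] at h1
  have h2 := Real.logb_nonpos hq1 hpos.le
    (fullRankFactor_le_one hR.one_lt (hn.component_le hR.pos))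
  have h3 : 0 ≤ Real.logb q (4 ^ s) := Real.logb_nonneg hq1 (one_le_pow₀ (by norm_num))
  have h4 : 0 ≤ Real.logb q 4 := Real.logb_nonneg hq1 (by norm_num)
  have hlow := lt_capacity_amc hR hn h
  rw [Real.logb_mul (by positivity) hpos.ne'] at hlow
  have hup := capacity_amc_le hR hn h
  rw [abs_le]
  constructor <;> linarith

end

end AMC

theorem mainTheorem9 {R : Type*} [CommRing R] [Finite R] (q s : ℕ) (π : R)
    (hR : AMC.IsFiniteChainRing R q s π) :
    -- capacity, and its bounds, for each admissible choice of the parameters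
    (∀ (n : ℕ) (μ τ : AMC.Shape s), τ.BoundedBy n → τ.IsSubshape μ →
      (AMC.matricesOfShape π n μ τ).Nonempty ∧
      (∀ p, AMC.channelInformation q (AMC.amc π n μ τ) p ≤
        AMC.channelInformation q (AMC.amc π n μ τ) (AMC.uniformInput _)) ∧
      AMC.channelInformation q (AMC.amc π n μ τ) (AMC.uniformInput _) =
        AMC.capacity q (AMC.amc π n μ τ) ∧
      AMC.capacity q (AMC.amc π n μ τ) =
        Real.logb q (Nat.card (AMC.matrixModule π n μ)) -
          Real.logb q (Nat.card (AMC.matricesOfShape π n μ τ)) ∧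
      ∑ i ∈ Finset.Icc 1 s, ((n : ℝ) - τ i) * ((μ i : ℝ) - τ i) -
          Real.logb q (4 ^ s * AMC.fullRankFactor q n τ) <
        AMC.capacity q (AMC.amc π n μ τ) ∧
      AMC.capacity q (AMC.amc π n μ τ) ≤
        ∑ i ∈ Finset.Icc 1 s, ((n : ℝ) - τ i) * ((μ i : ℝ) - τ i) -
          Real.logb q (AMC.fullRankFactor q n τ) ∧
      ((∃ i ∈ Finset.Icc 1 s, τ (i - 1) < τ i ∧ τ i < μ i) →
        AMC.capacity q (AMC.amc π n μ τ) <
          ∑ i ∈ Finset.Icc 1 s, ((n : ℝ) - τ i) * ((μ i : ℝ) - τ i) -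
            Real.logb q (AMC.fullRankFactor q n τ))) ∧
    -- asymptotic capacity: the packet length `m = μₛ` tends to infinity while the ratios
    -- `n / m`, `μ / m` and `τ / m` stay fixed
    (∀ (nbar : ℝ) (μbar τbar : ℕ → ℝ) (n : ℕ → ℕ) (μ τ : ℕ → AMC.Shape s),
      0 < nbar →
      (∀ k, (τ k).BoundedBy (n k) ∧ (τ k).IsSubshape (μ k)) →
      Filter.Tendsto (fun k => μ k s) Filter.atTop Filter.atTop →
      (∀ k, (n k : ℝ) = nbar * (μ k s : ℝ)) →
      (∀ k, ∀ i ∈ Finset.Icc 1 s, (μ k i : ℝ) = μbar i * (μ k s : ℝ)) →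
      (∀ k, ∀ i ∈ Finset.Icc 1 s, (τ k i : ℝ) = τbar i * (μ k s : ℝ)) →
      Filter.Tendsto
        (fun k => AMC.capacity q (AMC.amc π (n k) (μ k) (τ k)) /
          ((n k : ℝ) * ((μ k).size : ℝ)))
        Filter.atTop
        (nhds ((∑ i ∈ Finset.Icc 1 s, (nbar - τbar i) * (μbar i - τbar i)) /
          (nbar * ∑ i ∈ Finset.Icc 1 s, μbar i)))) := by
  refine ⟨fun n μ τ hn h => ⟨AMC.matricesOfShape_nonempty hR hn h,
    AMC.channelInformation_amc_le hR hn h,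
    (AMC.capacity_eq_of_forall_le (AMC.channelInformation_amc_le hR hn h)).symm,
    AMC.capacity_amc hR hn h, AMC.lt_capacity_amc hR hn h, AMC.capacity_amc_le hR hn h,
    AMC.capacity_amc_lt hR hn h⟩, ?_⟩
  intro nbar μbar τbar n μ τ hnbar hadm hm hn hμ hτ
  have hmR : Filter.Tendsto (fun k => (μ k s : ℝ)) Filter.atTop Filter.atTop :=
    tendsto_natCast_atTop_atTop.comp hm
  have hsmem : s ∈ Finset.Icc 1 s := Finset.mem_Icc.2 ⟨hR.pos, le_rfl⟩
  -- A single index with m > 0 fixes the signs of the ratios μbar.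
  obtain ⟨k₀, hk₀⟩ := (hmR.eventually_gt_atTop 0).exists
  have hsum : 0 < ∑ i ∈ Finset.Icc 1 s, μbar i := by
    refine Finset.sum_pos' (fun i hi => ?_) ⟨s, hsmem, ?_⟩
    · exact nonneg_of_mul_nonneg_left (hμ k₀ i hi ▸ Nat.cast_nonneg _) hk₀
    · exact pos_of_mul_pos_left (hμ k₀ s hsmem ▸ hk₀) hk₀.le
  set κ := nbar * ∑ i ∈ Finset.Icc 1 s, μbar i with hκ
  have hκpos : 0 < κ := mul_pos hnbar hsum
  have hden (k : ℕ) : (n k : ℝ) * ((μ k).size : ℝ) = κ * (μ k s : ℝ) ^ 2 := by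
    rw [AMC.Shape.size, Nat.cast_sum, Finset.sum_congr rfl (hμ k), ← Finset.sum_mul, hn, hκ]
    ring
  have hnum (k : ℕ) : ∑ i ∈ Finset.Icc 1 s, ((n k : ℝ) - τ k i) * ((μ k i : ℝ) - τ k i) =
      (∑ i ∈ Finset.Icc 1 s, (nbar - τbar i) * (μbar i - τbar i)) * (μ k s : ℝ) ^ 2 := by
    rw [Finset.sum_mul]
    refine Finset.sum_congr rfl fun i hi => ?_
    rw [hn, hμ k i hi, hτ k i hi]
    ring
  set a := ∑ i ∈ Finset.Icc 1 s, (nbar - τbar i) * (μbar i - τbar i)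
  -- Numerator and denominator are exactly a m² and κ m² up to the bounded error, which vanishes
  -- after division by κ m².
  have herr : Filter.Tendsto (fun k => (AMC.capacity q (AMC.amc π (n k) (μ k) (τ k)) -
      a * (μ k s : ℝ) ^ 2) / (κ * (μ k s : ℝ) ^ 2)) Filter.atTop (nhds 0) := by
    have hatTop : Filter.Tendsto (fun k => κ * (μ k s : ℝ) ^ 2) Filter.atTop Filter.atTop :=
      ((Filter.tendsto_pow_atTop two_ne_zero).comp hmR).const_mul_atTop hκpos
    refine squeeze_zero_norm (fun k => ?_)
      (hatTop.const_div_atTop (Real.logb q (4 ^ s) + Real.logb q 4))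
    rw [norm_div, Real.norm_eq_abs, Real.norm_of_nonneg (by positivity), ← hnum]
    exact div_le_div_of_nonneg_right (AMC.abs_capacity_amc_sub_le hR (hadm k).1 (hadm k).2)
      (by positivity)
  have hlim := herr.const_add (a / κ)
  rw [add_zero] at hlim
  refine hlim.congr' ?_
  filter_upwards [hmR.eventually_gt_atTop 0] with k hk
  rw [hden]
  field_simp
  ring
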